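/- Let $\mathbb F$ be a field of characteristic different from $2$ and $n\ge 0$. An $n$-SLTM is a strictly lower triangular $n\times n$ matrix $T=[t_{ij}]$ over $\mathbb F$. Let $\mathcal A(T)$ be the commutative unital $\mathbb F$-algebra generated by $X_1,\dots,X_n$ with relations $X_i^2=\sum_{j<i}t_{ij}X_jX_i$ ($1\le i\le n$), graded by $\deg X_i=2$; write $T\sim S$ if $\mathcal A(T)$ and $\mathcal A(S)$ are isomorphic as graded $\mathbb F$-algebras (by degree-preserving isomorphisms). For a row $r$ let $c_r$ be the largest column $c$ with $t_{rc}\neq0$, and $c_r=0$ if row $r$ is zero. Let $\Delta_{i,j,k}(T)=2t_{ki}+t_{kj}t_{ji}$. For $a,b$ let $\mu_{[a,b[}(r)$ be the number of columns $c$ with $a\le c<b$ and $t_{rc}\ne0$. *First reduced echelon form (1-REF).* $T$ is in 1-REF if $T=0$, or: (1) all zero rows are above all nonzero rows; (2) for every nonzero row $r$ one has $c_r>1$ and $\Delta_{i,c_r,r}(T)\neq0$ for some $1\le i<c_r$; (3) $c_r\le c_{r+1}$ whenever rows $r,r+1$ are nonzero. *Wall.* If $T\ne0$ is in 1-REF,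 its wall is $\mathbb W(T)=(r_1,\dots,r_h)$, where $r_1$ is the first nonzero row, $r_{j+1}=\min\{r>r_j: c_r\ge r_j\}$ as long as this set is nonempty, and $h$ is the last index reached; $\mathbb W(0)=(0)$. For an arbitrary $T$, $\mathbb W(T):=\mathbb W(R)$ for any $R\sim T$ in 1-REF. Given $\mathbb W(T)=(r_1,\dots,r_h)$, put $r_0=1$, $r_{h+1}=n+1$. *Second reduced echelon form (2-REF).* $T$ is in 2-REF if $T=0$, or $T\nsim 0$ and, with $\mathbb W(T)=(r_1,\dots,r_h)$: (1) $T$ has exactly $r_1-1$ zero rows, and they are above the nonzero rows; (2) for every nonzero row $r$ one has $c_r>1$ and $\Delta_{i,c_r,r}(T)\neq 0$ for some $1\le i<c_r$, and moreover $r_{j-1}\le c_r<r_j$ whenever $1\le j\le h$ and $r_j\le r<r_{j+1}$; (3) $\mu_{[r_{j-1},r_j[}(r)\le\mu_{[r_{j-1},r_j[}(r+1)$ whenever $1\le j\le h$ and $r_j\le r<r_{j+1}-1$. *Measure sequence.* For $T$ in 2-REF with wall $(r_1,\dots,r_h)$ and $1\le j\le h$, let $r_{j1}=r_j$ and, as long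 as such a row exists, let $r_{j,k+1}$ be the least $r$ with $r_{jk}<r<r_{j+1}$ and $\mu_{[r_{j-1},r_j[}(r)>\mu_{jk}$, where $\mu_{jk}:=\mu_{[r_{j-1},r_j[}(r_{jk})$. Let $M_j(T)$ be the $2$-row matrix with columns $(r_{jk},\mu_{jk})$, $k=1,2,\dots$, and $\mathbb M(T):=(M_1(T),\dots,M_h(T))$. (For $T=0$, where $\mathbb W(0)=(0)$, this gives the single column $(0,0)$.) For an arbitrary $T$, $\mathbb M(T):=\mathbb M(V)$ for any $V\sim T$ in 2-REF. **Theorem.** (0) Walls are well defined: every $n$-SLTM $T$ is equivalent under $\sim$ to some matrix in 1-REF, and all matrices in 1-REF equivalent to $T$ have the same wall. (i) ($\mathbb M$-Test) If $S,T$ are $n$-SLTMs in 2-REF with $\mathbb W(S)=\mathbb W(T)$ and $S\sim T$, then $\mathbb M(S)=\mathbb M(T)$. (ii) Measure sequences are well defined: every $n$-SLTM $T$ is equivalent to some matrix in 2-REF, and all matrices in 2-REF equivalent to $T$ have the same measure sequence. (iii) If $S,T$ are $n$-SLTMs with $S\sim T$, then $\mathbb M(S)=\mathbb M(T)$. -/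

import Mathlib

/-- Strictly lower triangular `n × n` matrices with entries in `F`. -/
def SLTM (F : Type*) [Field F] (n : ℕ) : Type _ :=
  {T : Matrix (Fin n) (Fin n) F // ∀ i j : Fin n, i ≤ j → T i j = 0}

namespace SLTM

instance {F : Type*} [Field F] {n : ℕ} : Zero (SLTM F n) :=
  ⟨⟨0, fun _ _ _ => rfl⟩⟩

/-! ### The nil graded algebra of a strictly lower triangular matrix -/

/-- The ideal generated by the relations `X_i ^ 2 = ∑_{j < i} t_{ij} X_j X_i`
(for the first index the sum is empty). -/
noncomputable def relIdeal {F : Type*} [Field F] {n : ℕ} (T : SLTM F n) :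
    Ideal (MvPolynomial (Fin n) F) :=
  Ideal.span (Set.range fun i : Fin n =>
    MvPolynomial.X i ^ 2 -
      ∑ j ∈ Finset.univ.filter (fun j : Fin n => j < i),
        MvPolynomial.C (T.1 i j) * MvPolynomial.X j * MvPolynomial.X i)

/-- The commutative algebra `A(T)`. -/
abbrev NilAlgebra {F : Type*} [Field F] {n : ℕ} (T : SLTM F n) : Type _ :=
  MvPolynomial (Fin n) F ⧸ T.relIdeal

/-- The homogeneous component of degree `d` of `A(T)`, for the grading with `deg X_i = 2`. -/
noncomputable def component {F : Type*} [Field F] {n : ℕ} (T : SLTM F n) (d : ℕ) :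
    Submodule F T.NilAlgebra :=
  (MvPolynomial.weightedHomogeneousSubmodule F (fun _ : Fin n => (2 : ℕ)) d).map
    (Ideal.Quotient.mkₐ F T.relIdeal).toLinearMap

/-- `T ∼ S`: the algebras `A(T)` and `A(S)` are isomorphic through an isomorphism of unital
`F`-algebras that preserves degrees in both directions. -/
def Equivalent {F : Type*} [Field F] {n : ℕ} (T S : SLTM F n) : Prop :=
  ∃ φ : T.NilAlgebra ≃ₐ[F] S.NilAlgebra,
    ∀ d : ℕ, (T.component d).map φ.toLinearMap = S.component d

/-! ### Entries, leaders and measures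

Rows and columns are numbered `1, …, n`. -/

/-- The entry `t_{rc}` for `1 ≤ r, c ≤ n` (and `0` outside this range). -/
def entry {F : Type*} [Field F] {n : ℕ} (T : SLTM F n) (r c : ℕ) : F :=
  if h : (1 ≤ r ∧ r ≤ n) ∧ (1 ≤ c ∧ c ≤ n) then
    T.1 ⟨r - 1, by omega⟩ ⟨c - 1, by omega⟩
  else 0

/-- `Δ^{(α)}_{i,j,k}(T) = α t_{ki} + t_{kj} t_{ji}`. -/
def Delta {F : Type*} [Field F] {n : ℕ} (T : SLTM F n) (α : F) (i j k : ℕ) : F :=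
  α * T.entry k i + T.entry k j * T.entry j i

open Classical in
/-- The column `c_r` of the leader (last nonzero entry) of the `r`-th row; `0` if that row is
zero. -/
noncomputable def lead {F : Type*} [Field F] {n : ℕ} (T : SLTM F n) (r : ℕ) : ℕ :=
  ((Finset.Icc 1 n).filter (fun c => T.entry r c ≠ 0)).sup id

/-- The `r`-th row is zero. -/
def RowZero {F : Type*} [Field F] {n : ℕ} (T : SLTM F n) (r : ℕ) : Prop :=
  ∀ c : ℕ, 1 ≤ c → c ≤ n → T.entry r c = 0

open Classical in
/-- The number of nonzero entries of the `r`-th row in the columns `a ≤ c < b`. -/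
noncomputable def rowMeasure {F : Type*} [Field F] {n : ℕ} (T : SLTM F n) (a b r : ℕ) : ℕ :=
  ((Finset.Ico a b).filter (fun c => T.entry r c ≠ 0)).card

open Classical in
/-- The sequence `r = s_1 < s_2 < ⋯` in which `s_{k+1}` is the least `s` with
`s_k < s ≤ N` and `P s_k s`; it stops when there is no such `s`. -/
noncomputable def greedyChain (P : ℕ → ℕ → Prop) (N r : ℕ) : List ℕ :=
  if h : ((Finset.Ioc r N).filter (P r)).Nonempty then
    r :: greedyChain P N (((Finset.Ioc r N).filter (P r)).min' h)
  else [r]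
termination_by N - r
decreasing_by
  have h1 := Finset.min'_mem _ h
  rw [Finset.mem_filter, Finset.mem_Ioc] at h1
  omega

/-! ### First reduced echelon form and walls -/

/-- First reduced echelon form. -/
def IsFirstREF {F : Type*} [Field F] {n : ℕ} (T : SLTM F n) : Prop :=
  T = 0 ∨
    ((∀ r s : ℕ, 1 ≤ r → r ≤ n → 1 ≤ s → s ≤ n → T.RowZero r → ¬ T.RowZero s → r < s) ∧
      (∀ r : ℕ, 1 ≤ r → r ≤ n → ¬ T.RowZero r →
        1 < T.lead r ∧ ∃ i : ℕ, 1 ≤ i ∧ i < T.lead r ∧ T.Delta 2 i (T.lead r) r ≠ 0) ∧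
      (∀ r : ℕ, 1 ≤ r → r + 1 ≤ n → ¬ T.RowZero r → ¬ T.RowZero (r + 1) →
        T.lead r ≤ T.lead (r + 1)))

open Classical in
/-- The wall `(r_1, …, r_h)` of a matrix in first reduced echelon form: `r_1` is the first
nonzero row and `r_{j+1}` is the first row `r > r_j` with `c_r ≥ r_j`. The wall of the zero
matrix is `(0)`. -/
noncomputable def firstWall {F : Type*} [Field F] {n : ℕ} (T : SLTM F n) : List ℕ :=
  if h : ((Finset.Icc 1 n).filter (fun r => ¬ T.RowZero r)).Nonempty then
    greedyChain (fun r s => r ≤ T.lead s) n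
      (((Finset.Icc 1 n).filter (fun r => ¬ T.RowZero r)).min' h)
  else [0]

open Classical in
/-- The wall of an arbitrary matrix: the wall of an equivalent matrix in first reduced echelon
form. -/
noncomputable def wall {F : Type*} [Field F] {n : ℕ} (T : SLTM F n) : List ℕ :=
  if h : ∃ R : SLTM F n, R.IsFirstREF ∧ T.Equivalent R then h.choose.firstWall else []

/-- The numbers `r_0 = 1`, `r_1, …, r_h`, `r_{h+1} = n + 1`, where `(r_1, …, r_h)` is the wall
of `T`. -/
noncomputable def bound {F : Type*} [Field F] {n : ℕ} (T : SLTM F n) (j : ℕ) : ℕ :=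
  (1 :: (T.wall ++ [n + 1])).getD j 0

/-- For `1 ≤ j ≤ h`, the number `μ` of nonzero entries of the `r`-th row in the columns
`r_{j-1} ≤ c < r_j` of the `j`-th brick. -/
noncomputable def brickMeasure {F : Type*} [Field F] {n : ℕ} (T : SLTM F n) (j r : ℕ) : ℕ :=
  T.rowMeasure (T.bound (j - 1)) (T.bound j) r

/-! ### Second reduced echelon form and measure sequences -/

open Classical in
/-- Second reduced echelon form. -/
def IsSecondREF {F : Type*} [Field F] {n : ℕ} (T : SLTM F n) : Prop :=
  T = 0 ∨
    (¬ T.Equivalent 0 ∧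
      (((Finset.Icc 1 n).filter (fun r => T.RowZero r)).card + 1 = T.bound 1 ∧
        ∀ r s : ℕ, 1 ≤ r → r ≤ n → 1 ≤ s → s ≤ n → T.RowZero r → ¬ T.RowZero s → r < s) ∧
      ((∀ r : ℕ, 1 ≤ r → r ≤ n → ¬ T.RowZero r →
          1 < T.lead r ∧ ∃ i : ℕ, 1 ≤ i ∧ i < T.lead r ∧ T.Delta 2 i (T.lead r) r ≠ 0) ∧
        ∀ j : ℕ, 1 ≤ j → j ≤ T.wall.length → ∀ r : ℕ, T.bound j ≤ r → r < T.bound (j + 1) →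
          T.bound (j - 1) ≤ T.lead r ∧ T.lead r < T.bound j) ∧
      (∀ j : ℕ, 1 ≤ j → j ≤ T.wall.length → ∀ r : ℕ, T.bound j ≤ r → r + 1 < T.bound (j + 1) →
        T.brickMeasure j r ≤ T.brickMeasure j (r + 1)))

/-- The matrix `M_j(T)`, as the list of its columns `(r_{jk}, μ_{jk})`: one starts with
`r_{j1} = r_j`, and `r_{j,k+1}` is the first row `r` with `r_{jk} < r < r_{j+1}` whose measure in
the `j`-th brick is larger than that of the row `r_{jk}`. -/
noncomputable def measureMatrix {F : Type*} [Field F] {n : ℕ} (T : SLTM F n) (j : ℕ) :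
    List (ℕ × ℕ) :=
  (greedyChain (fun r s => T.brickMeasure j r < T.brickMeasure j s)
    (T.bound (j + 1) - 1) (T.bound j)).map (fun r => (r, T.brickMeasure j r))

/-- The sequence `(M_1(T), …, M_h(T))` of a matrix in second reduced echelon form. -/
noncomputable def secondMeasureSeq {F : Type*} [Field F] {n : ℕ} (T : SLTM F n) :
    List (List (ℕ × ℕ)) :=
  (List.range T.wall.length).map (fun j => T.measureMatrix (j + 1))

open Classical in
/-- The measure sequence of an arbitrary matrix: that of an equivalent matrix in second reduced
echelon form. -/
noncomputable def measureSeq {F : Type*} [Field F] {n : ℕ} (T : SLTM F n) :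
    List (List (ℕ × ℕ)) :=
  if h : ∃ V : SLTM F n, V.IsSecondREF ∧ T.Equivalent V then h.choose.secondMeasureSeq else []

end SLTM

namespace SLTM

/-! The wall and the measures are read off an intrinsic filtration of the degree-two component of
`A(T)`. Put `V_0 = 0` and let `V_{j+1}` be the span of the degree-two elements `x` with `x²` in `V_j
· V_j` (`sqFilt`). Any graded isomorphism respects it.

Completing the square turns the `k`-th relation into `(X_k - ρ_k)² = ρ_k²`, with `ρ_k` half of the
linear form of row `k`. Conversely, a linear form whose square lies in the square of the span of the
generators of index below `b`, but which is not in that span, is a multiple of some `X_k - ρ_k`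
(`exists_smul_sqVec`). If the rows split into blocks (`Layered`), each row having its leader in the
preceding block and some nonzero `Δ` at the leader, then `V_j` is the span of all generators before
the `j`-th cut (`Layered.sqFilt_eq`). The dimensions of the `V_j` therefore determine the cuts,
hence the wall.

For measures, an isomorphism between two matrices layered by the same cuts permutes, block by block,
the lines through the `X_k - ρ_k`. Modulo the lower layer it acts on a block as a monomial matrix,
and it matches the squares `ρ_k²` up to nonzero scalars. Products of two distinct coordinates of
`ρ_k` within the preceding block are visible in `ρ_k²`, so the supports there have the same size
(`Layered.exists_perm`). Since measures increase within the blocks of a 2-REF, equal multisets of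
measures are equal sequences (`le_of_perm_of_monotone`).

Both echelon forms exist by minimization over the equivalence class: a lexicographically minimal
sequence of leaders gives a 1-REF, and a lexicographically minimal sequence of measures, among
matrices with the same layers and strong rows, gives a 2-REF. The only moves are the exchange of
neighbouring generators and a shear which moves a leader to the left. -/

variable {F : Type*} [Field F] {n : ℕ}

/-! ### The degree-two component as a space of linear forms -/

/-- The linear form with coefficients `v`, as a polynomial. -/
noncomputable def linearForm : (Fin n → F) →ₗ[F] MvPolynomial (Fin n) F :=
  Fintype.linearCombination F MvPolynomial.X

lemma linearForm_apply (v : Fin n → F) :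
    linearForm v = ∑ i, MvPolynomial.C (v i) * MvPolynomial.X i := by
  simp [linearForm, Fintype.linearCombination_apply, MvPolynomial.smul_eq_C_mul]

lemma linearForm_single (i : Fin n) :
    linearForm (Pi.single i 1) = (MvPolynomial.X i : MvPolynomial (Fin n) F) := by
  simp [linearForm]

lemma relIdeal_eq (T : SLTM F n) : T.relIdeal = Ideal.span (Set.range fun i : Fin n =>
    (MvPolynomial.X i * (MvPolynomial.X i - linearForm (T.1 i)) : MvPolynomial (Fin n) F)) := by
  unfold relIdeal
  congr 2
  funext i
  rw [linearForm_apply, mul_sub, ← sq, Finset.mul_sum, Finset.sum_filter]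
  congr 1
  refine Finset.sum_congr rfl fun j _ => ?_
  split_ifs with h
  · ring
  · simp [T.2 i j (not_lt.1 h)]

/-- The element of degree two of `A(T)` with coordinates `v`. -/
noncomputable def gen (T : SLTM F n) : (Fin n → F) →ₗ[F] T.NilAlgebra :=
  (Ideal.Quotient.mkₐ F T.relIdeal).toLinearMap ∘ₗ linearForm

lemma gen_eq (T : SLTM F n) (v : Fin n → F) :
    T.gen v = Ideal.Quotient.mk T.relIdeal (linearForm v) := rfl

lemma gen_rel (T : SLTM F n) (i : Fin n) :
    T.gen (Pi.single i 1) * (T.gen (Pi.single i 1) - T.gen (T.1 i)) = 0 := by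
  simp only [gen_eq, linearForm_single, ← map_sub, ← map_mul]
  rw [Ideal.Quotient.eq_zero_iff_mem, relIdeal_eq]
  exact Ideal.subset_span ⟨i, rfl⟩

lemma isWeightedHomogeneous_linearForm (v : Fin n → F) :
    (linearForm v).IsWeightedHomogeneous (fun _ : Fin n => (2 : ℕ)) 2 := by
  rw [linearForm_apply]
  exact MvPolynomial.IsWeightedHomogeneous.sum _ _ _ fun i _ =>
    (MvPolynomial.isWeightedHomogeneous_X F _ i).C_mul _

lemma exists_linearForm {p : MvPolynomial (Fin n) F}
    (hp : p.IsWeightedHomogeneous (fun _ : Fin n => (2 : ℕ)) 2) : ∃ v, p = linearForm v := by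
  have h : p ∈ LinearMap.range (linearForm : (Fin n → F) →ₗ[F] _) := by
    rw [MvPolynomial.as_sum p]
    refine Submodule.sum_mem _ fun m hm => ?_
    have h1 : m.sum (fun _ k => k) = 1 := by
      have := hp (MvPolynomial.mem_support_iff.1 hm)
      simp only [Finsupp.weight_apply, Finsupp.sum, smul_eq_mul, ← Finset.sum_mul] at this ⊢
      omega
    obtain ⟨i, rfl⟩ := (Finsupp.sum_eq_one_iff m).1 h1
    refine ⟨p.coeff (Finsupp.single i 1) • Pi.single i 1, ?_⟩
    rw [map_smul, linearForm_single, MvPolynomial.X, MvPolynomial.smul_monomial, smul_eq_mul,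
      mul_one]
  obtain ⟨v, hv⟩ := h
  exact ⟨v, hv.symm⟩

lemma component_two (T : SLTM F n) : T.component 2 = LinearMap.range T.gen := by
  ext x
  constructor
  · rintro ⟨p, hp, rfl⟩
    obtain ⟨v, rfl⟩ := exists_linearForm hp
    exact ⟨v, rfl⟩
  · rintro ⟨v, rfl⟩
    exact ⟨linearForm v, isWeightedHomogeneous_linearForm v, rfl⟩

/-! ### Coordinates -/

/-- The value at zero. -/
noncomputable def ev0 : MvPolynomial (Fin n) F →ₗ[F] F :=
  (MvPolynomial.aeval (0 : Fin n → F)).toLinearMap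

lemma ev0_mul (p q : MvPolynomial (Fin n) F) : ev0 (p * q) = ev0 p * ev0 q := by simp [ev0]

lemma ev0_C (a : F) : ev0 (MvPolynomial.C a : MvPolynomial (Fin n) F) = a := by simp [ev0]

lemma ev0_one : ev0 (1 : MvPolynomial (Fin n) F) = 1 := by simp [ev0]

lemma ev0_linearForm (v : Fin n → F) : ev0 (linearForm v) = 0 := by
  simp [ev0, linearForm_apply]

lemma pderiv_linearForm (i : Fin n) (v : Fin n → F) :
    MvPolynomial.pderiv i (linearForm v) = MvPolynomial.C (v i) := by
  simp [linearForm_apply, MvPolynomial.pderiv_X, Pi.single_apply]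

/-- The functional on polynomials inducing the coefficient of `X_i X_k`, doubled. -/
noncomputable def polyCoef (T : SLTM F n) (i k : Fin n) : MvPolynomial (Fin n) F →ₗ[F] F :=
  (2 : F) • (ev0 ∘ₗ (MvPolynomial.pderiv i).toLinearMap ∘ₗ (MvPolynomial.pderiv k).toLinearMap) +
  T.1 k i • (ev0 ∘ₗ (MvPolynomial.pderiv k).toLinearMap ∘ₗ (MvPolynomial.pderiv k).toLinearMap)

/-- Linear forms vanish at zero, so a second derivative of the product survives only when both forms
are differentiated, leaving the value of `q` at zero. -/
lemma polyCoef_mul (T : SLTM F n) (i k : Fin n) (q : MvPolynomial (Fin n) F) (a b : Fin n → F) :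
    T.polyCoef i k (q * (linearForm a * linearForm b)) =
      2 * ev0 q * (a i * b k + a k * b i + T.1 k i * (a k * b k)) := by
  simp only [polyCoef, LinearMap.add_apply, LinearMap.smul_apply, LinearMap.comp_apply,
    Derivation.coeFn_coe, Derivation.leibniz, smul_eq_mul, map_add,
    pderiv_linearForm, ev0_mul, ev0_linearForm, MvPolynomial.pderiv_C, map_zero, ev0_C]
  ring

lemma eq_zero_of_mem_relIdeal {T : SLTM F n} (f : MvPolynomial (Fin n) F →ₗ[F] F)
    (hf : ∀ q i, f (q * (MvPolynomial.X i * (MvPolynomial.X i - linearForm (T.1 i)))) = 0)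
    {p : MvPolynomial (Fin n) F} (hp : p ∈ T.relIdeal) : f p = 0 := by
  rw [relIdeal_eq, Ideal.mem_span_range_iff_exists_fun] at hp
  obtain ⟨c, rfl⟩ := hp
  rw [map_sum]
  exact Finset.sum_eq_zero fun i _ => hf _ _

/-- Only the `k`-th relation needs a cancellation: its term `-t_{ki} X_i X_k` is compensated by the
weight `t_{ki}` given to `X_k²`. -/
lemma polyCoef_eq_zero (T : SLTM F n) {i k : Fin n} (h : i < k) {p : MvPolynomial (Fin n) F}
    (hp : p ∈ T.relIdeal) : T.polyCoef i k p = 0 := by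
  refine eq_zero_of_mem_relIdeal _ (fun q j => ?_) hp
  rw [← linearForm_single, ← map_sub, polyCoef_mul]
  simp only [Pi.sub_apply, Pi.single_apply]
  rcases eq_or_ne k j with rfl | hk
  · simp [h.ne, T.2 k k le_rfl]
  · rcases eq_or_ne i j with rfl | hi
    · simp [hk, T.2 i k h.le]
    · simp [hk, hi]

/-- A functional on polynomials vanishing on the relations, as a functional on `A(T)`. -/
noncomputable def liftFunctional (T : SLTM F n) (f : MvPolynomial (Fin n) F →ₗ[F] F)
    (hf : ∀ p ∈ T.relIdeal, f p = 0) : T.NilAlgebra →ₗ[F] F :=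
  ((T.relIdeal.restrictScalars F).liftQ f fun p hp => hf p hp) ∘ₗ
    (Submodule.Quotient.restrictScalarsEquiv F T.relIdeal).symm.toLinearMap

lemma liftFunctional_mk (T : SLTM F n) (f : MvPolynomial (Fin n) F →ₗ[F] F)
    (hf : ∀ p ∈ T.relIdeal, f p = 0) (p : MvPolynomial (Fin n) F) :
    T.liftFunctional f hf (Ideal.Quotient.mk T.relIdeal p) = f p := rfl

/-- The coefficient of `X_i X_k`, for `i < k`, doubled. -/
noncomputable def coef (T : SLTM F n) {i k : Fin n} (h : i < k) : T.NilAlgebra →ₗ[F] F :=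
  T.liftFunctional (T.polyCoef i k) fun _ hp => T.polyCoef_eq_zero h hp

lemma coef_gen_mul (T : SLTM F n) {i k : Fin n} (h : i < k) (a b : Fin n → F) :
    T.coef h (T.gen a * T.gen b) = 2 * (a i * b k + a k * b i + T.1 k i * (a k * b k)) := by
  rw [gen_eq, gen_eq, ← map_mul, coef, liftFunctional_mk,
    ← one_mul (linearForm a * linearForm b), polyCoef_mul, ev0_one, mul_one]

/-- The relations are quadratic, so first derivatives at zero kill the ideal and recover the
coordinates. -/
lemma gen_injective (T : SLTM F n) : Function.Injective T.gen := by
  intro a b hab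
  rw [← sub_eq_zero, ← map_sub] at hab
  rw [← sub_eq_zero]
  generalize a - b = v at hab ⊢
  funext i
  rw [gen_eq, Ideal.Quotient.eq_zero_iff_mem] at hab
  have := eq_zero_of_mem_relIdeal (T := T) (ev0 ∘ₗ (MvPolynomial.pderiv i).toLinearMap)
    (fun q j => ?_) hab
  · simpa [pderiv_linearForm, ev0_C] using this
  · rw [← linearForm_single, ← map_sub]
    simp only [LinearMap.comp_apply, Derivation.coeFn_coe, Derivation.leibniz, smul_eq_mul,
      map_add, ev0_mul, ev0_linearForm]
    ring

/-! ### Isomorphisms -/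

lemma map_component_le {T S : SLTM F n} (f : T.NilAlgebra →ₐ[F] S.NilAlgebra)
    (hf : ∀ i, f (T.gen (Pi.single i 1)) ∈ S.component 2) (d : ℕ) :
    (T.component d).map f.toLinearMap ≤ S.component d := by
  rintro _ ⟨_, ⟨p, hp, rfl⟩, rfl⟩
  choose y hy hfy using hf
  refine MvPolynomial.IsWeightedHomogeneous.induction_on
    (motive := fun p _ => f (Ideal.Quotient.mk T.relIdeal p) ∈ S.component d)
    ?_ ?_ ?_ hp
  · simp
  · intro p q _ _ h1 h2
    rw [map_add, map_add]
    exact Submodule.add_mem _ h1 h2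
  · intro m r hm
    refine ⟨MvPolynomial.C r * ∏ i, y i ^ m i, ?_, ?_⟩
    · refine MvPolynomial.IsWeightedHomogeneous.C_mul ?_ r
      have := MvPolynomial.IsWeightedHomogeneous.prod Finset.univ (fun i => y i ^ m i)
        (fun i => m i • 2) (w := fun _ : Fin n => (2 : ℕ)) fun i _ =>
          MvPolynomial.IsWeightedHomogeneous.pow (hy i) (m i)
      rw [← hm, Finsupp.weight_apply, Finsupp.sum_fintype _ _ (by simp)]
      exact this
    · rw [MvPolynomial.monomial_eq, Finsupp.prod_fintype _ _ (by simp)]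
      have hC : ∀ (R : SLTM F n), Ideal.Quotient.mk R.relIdeal (MvPolynomial.C r) =
        algebraMap F R.NilAlgebra r := fun _ => rfl
      simp only [AlgHom.toLinearMap_apply, Ideal.Quotient.mkₐ_eq_mk, map_mul, map_prod, map_pow,
        hC, AlgHom.commutes]
      congr 1
      refine Finset.prod_congr rfl fun i _ => ?_
      have := hfy i
      rw [gen_eq, linearForm_single] at this
      rw [← this]
      rfl

lemma exists_algHom (T S : SLTM F n) (P : (Fin n → F) →ₗ[F] (Fin n → F))
    (h : ∀ i, S.gen (P (Pi.single i 1)) *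
      (S.gen (P (Pi.single i 1)) - S.gen (P (T.1 i))) = 0) :
    ∃ f : T.NilAlgebra →ₐ[F] S.NilAlgebra, ∀ v, f (T.gen v) = S.gen (P v) := by
  let g : MvPolynomial (Fin n) F →ₐ[F] S.NilAlgebra :=
    MvPolynomial.aeval fun i => S.gen (P (Pi.single i 1))
  have hg : ∀ v, g (linearForm v) = S.gen (P v) := by
    intro v
    have : g.toLinearMap ∘ₗ linearForm = S.gen ∘ₗ P := by
      refine LinearMap.pi_ext' fun i => LinearMap.ext_ring ?_
      simp [linearForm_single, g]
    exact LinearMap.congr_fun this v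
  refine ⟨Ideal.Quotient.liftₐ T.relIdeal g ?_, fun v => ?_⟩
  · intro p hp
    rw [← RingHom.mem_ker]
    revert hp
    change p ∈ T.relIdeal → p ∈ RingHom.ker g
    suffices T.relIdeal ≤ RingHom.ker g from fun hp => this hp
    rw [relIdeal_eq, Ideal.span_le]
    rintro _ ⟨i, rfl⟩
    change g (MvPolynomial.X i * (MvPolynomial.X i - linearForm (T.1 i))) = 0
    rw [← linearForm_single, map_mul, map_sub, hg, hg]
    exact h i
  · exact hg v

lemma algHom_ext_gen {T S : SLTM F n} {f g : T.NilAlgebra →ₐ[F] S.NilAlgebra}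
    (h : ∀ v, f (T.gen v) = g (T.gen v)) : f = g := by
  refine Ideal.Quotient.algHom_ext _ (MvPolynomial.algHom_ext fun i => ?_)
  have := h (Pi.single i 1)
  rwa [gen_eq, linearForm_single] at this

/-- An invertible linear substitution gives a graded isomorphism once it and its inverse respect the
defining relations. -/
lemma equivalent_of_linear {T S : SLTM F n} (P Q : (Fin n → F) →ₗ[F] (Fin n → F))
    (hPQ : ∀ v, P (Q v) = v) (hQP : ∀ v, Q (P v) = v)
    (hP : ∀ i, S.gen (P (Pi.single i 1)) *
      (S.gen (P (Pi.single i 1)) - S.gen (P (T.1 i))) = 0)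
    (hQ : ∀ i, T.gen (Q (Pi.single i 1)) *
      (T.gen (Q (Pi.single i 1)) - T.gen (Q (S.1 i))) = 0) : T.Equivalent S := by
  obtain ⟨f, hf⟩ := exists_algHom T S P hP
  obtain ⟨g, hg⟩ := exists_algHom S T Q hQ
  have hfg : f.comp g = AlgHom.id F _ := algHom_ext_gen fun v => by simp [hf, hg, hPQ]
  have hgf : g.comp f = AlgHom.id F _ := algHom_ext_gen fun v => by simp [hf, hg, hQP]
  refine ⟨AlgEquiv.ofAlgHom f g hfg hgf, fun d => le_antisymm ?_ fun x hx => ?_⟩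
  · exact map_component_le f (fun i => by rw [component_two, hf]; exact ⟨_, rfl⟩) d
  · refine ⟨g x, map_component_le g (fun i => by rw [component_two, hg]; exact ⟨_, rfl⟩) d
      ⟨x, hx, rfl⟩, ?_⟩
    exact DFunLike.congr_fun hfg x

lemma Equivalent.refl (T : SLTM F n) : T.Equivalent T :=
  ⟨AlgEquiv.refl, fun d => Submodule.map_id (T.component d)⟩

lemma Equivalent.symm {T S : SLTM F n} (h : T.Equivalent S) : S.Equivalent T := by
  obtain ⟨φ, hφ⟩ := h
  refine ⟨φ.symm, fun d => ?_⟩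
  rw [← hφ d]
  ext x
  constructor
  · rintro ⟨_, ⟨y, hy, rfl⟩, rfl⟩
    simpa using hy
  · intro hx
    exact ⟨φ x, ⟨x, hx, rfl⟩, by simp⟩

lemma Equivalent.trans {T S R : SLTM F n} (h : T.Equivalent S) (h' : S.Equivalent R) :
    T.Equivalent R := by
  obtain ⟨φ, hφ⟩ := h
  obtain ⟨ψ, hψ⟩ := h'
  refine ⟨φ.trans ψ, fun d => ?_⟩
  rw [← hψ d, ← hφ d, ← Submodule.map_comp]
  rfl

/-! ### Lines of elements with small square -/

/-- The vectors supported on the (one-based) indices less than `b`. -/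
def lowVec (F : Type*) [Field F] (n b : ℕ) : Submodule F (Fin n → F) where
  carrier := {v | ∀ i : Fin n, b ≤ i + 1 → v i = 0}
  zero_mem' := fun _ _ => rfl
  add_mem' := fun ha hb i hi => by simp [ha i hi, hb i hi]
  smul_mem' := fun a v hv i hi => by simp [hv i hi]

lemma mem_lowVec {b : ℕ} {v : Fin n → F} :
    v ∈ lowVec F n b ↔ ∀ i : Fin n, b ≤ i + 1 → v i = 0 := Iff.rfl

lemma lowVec_mono {b c : ℕ} (h : b ≤ c) : lowVec F n b ≤ lowVec F n c :=
  fun _ hv i hi => hv i (h.trans hi)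

lemma lowVec_eq_span (b : ℕ) : lowVec F n b =
    Submodule.span F ((fun i : Fin n => Pi.single i (1 : F)) '' {i | (i : ℕ) + 1 < b}) := by
  apply le_antisymm
  · intro v hv
    rw [pi_eq_sum_univ' v]
    refine Submodule.sum_mem _ fun i _ => ?_
    by_cases hi : (i : ℕ) + 1 < b
    · exact Submodule.smul_mem _ _ (Submodule.subset_span ⟨i, hi, rfl⟩)
    · rw [hv i (not_lt.1 hi), zero_smul]
      exact Submodule.zero_mem _
  · rw [Submodule.span_le]
    rintro _ ⟨i, hi, rfl⟩ j hj
    rw [Set.mem_ofPred_eq] at hi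
    exact Pi.single_eq_of_ne (by rintro rfl; omega) _

/-- The span of the generators with (one-based) index less than `b`. -/
noncomputable def low (T : SLTM F n) (b : ℕ) : Submodule F T.NilAlgebra :=
  (lowVec F n b).map T.gen

lemma gen_mem_low (T : SLTM F n) {b : ℕ} {v : Fin n → F} :
    T.gen v ∈ T.low b ↔ v ∈ lowVec F n b :=
  ⟨fun ⟨_, hw, h⟩ => T.gen_injective h ▸ hw, fun h => ⟨v, h, rfl⟩⟩

/-- Rewriting a square `X_m²` through its relation brings in no generator of index larger than `m`.
-/
lemma coef_eq_zero_of_mem_low_mul (T : SLTM F n) {b : ℕ} {i k : Fin n} (h : i < k)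
    (hk : b ≤ k + 1) {p : T.NilAlgebra} (hp : p ∈ T.low b * T.low b) : T.coef h p = 0 := by
  refine Submodule.mul_induction_on hp ?_ fun x y hx hy => by rw [map_add, hx, hy, add_zero]
  rintro _ ⟨v, hv, rfl⟩ _ ⟨w, hw, rfl⟩
  simp [coef_gen_mul, hv k hk, hw k hk]

/-- Half of a row. -/
noncomputable def halfRow (T : SLTM F n) (k : Fin n) : Fin n → F := (2⁻¹ : F) • T.1 k

/-- The vector obtained from the `k`-th generator by completing the square. -/
noncomputable def sqVec (T : SLTM F n) (k : Fin n) : Fin n → F := Pi.single k 1 - T.halfRow k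

lemma halfRow_of_le (T : SLTM F n) {k i : Fin n} (h : k ≤ i) : T.halfRow k i = 0 := by
  simp [halfRow, T.2 k i h]

lemma sqVec_self (T : SLTM F n) (k : Fin n) : T.sqVec k k = 1 := by
  simp [sqVec, T.halfRow_of_le le_rfl]

lemma sqVec_of_lt (T : SLTM F n) {k i : Fin n} (h : k < i) : T.sqVec k i = 0 := by
  simp [sqVec, T.halfRow_of_le h.le, Pi.single_eq_of_ne h.ne']

lemma gen_sqVec_sq (h2 : (2 : F) ≠ 0) (T : SLTM F n) (k : Fin n) :
    T.gen (T.sqVec k) * T.gen (T.sqVec k) = T.gen (T.halfRow k) * T.gen (T.halfRow k) := by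
  have h := T.gen_rel k
  have h' : T.1 k = T.halfRow k + T.halfRow k := by
    rw [halfRow, ← add_smul, ← two_mul, mul_inv_cancel₀ h2, one_smul]
  rw [h', map_add] at h
  rw [sqVec, map_sub]
  linear_combination h

/-- Let `k` be the last index in the support of `v`. For every `i < k` the coefficient of `X_i X_k`
in the square must vanish, which reads `v_k (2 v_i + t_{ki} v_k) = 0` and determines `v_i` from
`v_k`. -/
lemma exists_smul_sqVec (h2 : (2 : F) ≠ 0) (T : SLTM F n) {b : ℕ} {v : Fin n → F}
    (hv : T.gen v * T.gen v ∈ T.low b * T.low b) (hb : v ∉ lowVec F n b) :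
    ∃ k : Fin n, b ≤ k + 1 ∧ ∃ a : F, a ≠ 0 ∧ v = a • T.sqVec k := by
  classical
  have hne : (Finset.univ.filter fun i : Fin n => v i ≠ 0).Nonempty := by
    rw [mem_lowVec] at hb
    push Not at hb
    obtain ⟨i, -, hi⟩ := hb
    exact ⟨i, by simpa using hi⟩
  obtain ⟨k, hk⟩ := Finset.exists_max_image _ id hne
  simp only [Finset.mem_filter, Finset.mem_univ, true_and, id_eq] at hk
  have hbk : b ≤ k + 1 := by
    by_contra hlt
    refine hb fun i hi => ?_
    by_contra h0
    have := hk.2 i h0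
    rw [Fin.le_def] at this
    omega
  refine ⟨k, hbk, v k, hk.1, ?_⟩
  funext i
  rcases lt_trichotomy i k with h | rfl | h
  · have h0 := T.coef_eq_zero_of_mem_low_mul h hbk hv
    rw [coef_gen_mul] at h0
    have h1 : v k * (2 * v i + T.1 k i * v k) = 0 := by
      have := (mul_eq_zero.1 h0).resolve_left h2
      linear_combination this
    have h3 := (mul_eq_zero.1 h1).resolve_left hk.1
    simp only [sqVec, halfRow, Pi.smul_apply, Pi.sub_apply, Pi.single_eq_of_ne h.ne, smul_eq_mul]
    field_simp
    linear_combination h3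
  · simp [sqVec_self]
  · rw [Pi.smul_apply, sqVec_of_lt _ h, smul_zero]
    by_contra h0
    exact absurd (hk.2 i h0) (not_le.2 h)

/-- The left-hand side is twice `coef` of the square of the half row at `X_i X_c`. A nonzero `Δ` at
a leader thus keeps that square out of all layers below the leader. -/
lemma delta_eq_zero_of_mem (h2 : (2 : F) ≠ 0) (T : SLTM F n) {b : ℕ} {k i c : Fin n} (h : i < c)
    (hc : b ≤ c + 1) (hk : T.gen (T.sqVec k) * T.gen (T.sqVec k) ∈ T.low b * T.low b) :
    T.1 k c * (2 * T.1 k i + T.1 k c * T.1 c i) = 0 := by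
  rw [gen_sqVec_sq h2] at hk
  have h0 := T.coef_eq_zero_of_mem_low_mul h hc hk
  rw [coef_gen_mul] at h0
  simp only [halfRow, Pi.smul_apply, smul_eq_mul] at h0
  field_simp at h0
  linear_combination h0

/-! ### Layers -/

/-- The rows are cut by `1 = b 0 ≤ b 1 ≤ ⋯ ≤ b (h + 1) = n + 1` into blocks, and the rows of a
block have their leaders in the preceding block and are not equivalent to zero rows. -/
structure Layered (T : SLTM F n) (b : ℕ → ℕ) (h : ℕ) : Prop where
  zero : b 0 = 1
  top : b (h + 1) = n + 1
  mono : ∀ j ≤ h, b j ≤ b (j + 1)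
  lt : ∀ j, 1 ≤ j → j ≤ h → b j < b (j + 1)
  row : ∀ j ≤ h, ∀ k : Fin n, b j ≤ k + 1 → k + 1 < b (j + 1) → T.1 k ∈ lowVec F n (b j)
  delta : ∀ j < h, ∀ k : Fin n, b (j + 1) ≤ k + 1 → k + 1 < b (j + 2) →
    ∃ c : Fin n, b j ≤ c + 1 ∧ T.1 k c ≠ 0 ∧ ∃ i < c, 2 * T.1 k i + T.1 k c * T.1 c i ≠ 0

namespace Layered

variable {T : SLTM F n} {b : ℕ → ℕ} {h : ℕ}

lemma mono' (hT : T.Layered b h) {i j : ℕ} (hij : i ≤ j) (hj : j ≤ h + 1) : b i ≤ b j := by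
  induction j, hij using Nat.le_induction with
  | base => exact le_rfl
  | succ j _ ih => exact (ih (by omega)).trans (hT.mono j (by omega))

lemma le (hT : T.Layered b h) {j : ℕ} (h1 : 1 ≤ j) (hj : j ≤ h) : b j ≤ n := by
  have := hT.lt j h1 hj
  have := hT.mono' (i := j + 1) (j := h + 1) (by omega) le_rfl
  rw [hT.top] at this
  omega

lemma exists_block (hT : T.Layered b h) {m : ℕ} (hm : m ≤ h + 1) {k : Fin n} (hk : b m ≤ k + 1) :
    ∃ j, m ≤ j ∧ j ≤ h ∧ b j ≤ k + 1 ∧ k + 1 < b (j + 1) := by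
  induction hm using Nat.decreasingInduction with
  | self =>
    have := k.2
    rw [hT.top] at hk
    omega
  | of_succ m hm ih =>
    by_cases hlt : (k : ℕ) + 1 < b (m + 1)
    · exact ⟨m, le_rfl, by omega, hk, hlt⟩
    · obtain ⟨j, h1, h2⟩ := ih (not_lt.1 hlt)
      exact ⟨j, by omega, h2⟩

lemma block_unique (hT : T.Layered b h) {i j k : ℕ} (hi : i ≤ h) (hj : j ≤ h) (h1 : b i ≤ k)
    (h2 : k < b (i + 1)) (h3 : b j ≤ k) (h4 : k < b (j + 1)) : i = j := by
  rcases lt_trichotomy i j with hlt | heq | hlt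
  · have := hT.mono' (i := i + 1) (j := j) hlt (by omega)
    omega
  · exact heq
  · have := hT.mono' (i := j + 1) (j := i) hlt (by omega)
    omega

lemma halfRow_mem (hT : T.Layered b h) {j : ℕ} (hj : j ≤ h) {k : Fin n} (h1 : b j ≤ k + 1)
    (h2 : k + 1 < b (j + 1)) : T.halfRow k ∈ lowVec F n (b j) :=
  Submodule.smul_mem _ _ (hT.row j hj k h1 h2)

lemma sqVec_sq_mem (hT : T.Layered b h) (hF : (2 : F) ≠ 0) {j : ℕ} (hj : j ≤ h) {k : Fin n}
    (h1 : b j ≤ k + 1) (h2 : k + 1 < b (j + 1)) :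
    T.gen (T.sqVec k) * T.gen (T.sqVec k) ∈ T.low (b j) * T.low (b j) := by
  rw [gen_sqVec_sq hF]
  exact Submodule.mul_mem_mul (T.gen_mem_low.2 (hT.halfRow_mem hj h1 h2))
    (T.gen_mem_low.2 (hT.halfRow_mem hj h1 h2))

lemma sqVec_notMem {T : SLTM F n} {b : ℕ} {k : Fin n} (hk : b ≤ k + 1) :
    T.sqVec k ∉ lowVec F n b := fun h => by
  have := h k hk
  rw [sqVec_self] at this
  exact one_ne_zero this

/-- Completed squares of later blocks are excluded by their nonzero `Δ`, so exactly the lines of the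
`j`-th block remain. -/
lemma exists_sqVec (hT : T.Layered b h) (hF : (2 : F) ≠ 0) {j : ℕ} (hj : j ≤ h) {v : Fin n → F}
    (hv : T.gen v * T.gen v ∈ T.low (b j) * T.low (b j)) (hb : v ∉ lowVec F n (b j)) :
    ∃ k : Fin n, b j ≤ k + 1 ∧ k + 1 < b (j + 1) ∧ ∃ a : F, a ≠ 0 ∧ v = a • T.sqVec k := by
  obtain ⟨k, hk, a, ha, rfl⟩ := exists_smul_sqVec hF T hv hb
  refine ⟨k, hk, ?_, a, ha, rfl⟩
  have hsq : T.gen (T.sqVec k) * T.gen (T.sqVec k) ∈ T.low (b j) * T.low (b j) := by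
    have := Submodule.smul_mem _ (a⁻¹ * a⁻¹) hv
    rwa [map_smul, smul_mul_smul_comm, smul_smul,
      show a⁻¹ * a⁻¹ * (a * a) = 1 by field_simp, one_smul] at this
  obtain ⟨m, h1, h2, h3, h4⟩ := hT.exists_block (m := j) (by omega) hk
  rcases h1.eq_or_lt with rfl | hlt
  · exact h4
  · obtain ⟨m, rfl⟩ : ∃ m', m = m' + 1 := ⟨m - 1, by omega⟩
    obtain ⟨c, hc, hc0, i, hi, hd⟩ := hT.delta m (by omega) k h3 h4
    have := delta_eq_zero_of_mem hF T hi
      ((hT.mono' (i := j) (j := m) (by omega) (by omega)).trans hc) hsq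
    exact absurd this (mul_ne_zero hc0 hd)

end Layered

/-! ### The intrinsic filtration by squares -/

/-- The subspaces of the component of degree two obtained by repeatedly taking the span of the
elements whose square lies in the square of the preceding subspace. -/
noncomputable def sqFilt (T : SLTM F n) : ℕ → Submodule F T.NilAlgebra
  | 0 => ⊥
  | j + 1 => Submodule.span F {x | x ∈ T.component 2 ∧ x * x ∈ T.sqFilt j * T.sqFilt j}

lemma Layered.sqFilt_eq {T : SLTM F n} {b : ℕ → ℕ} {h : ℕ} (hT : T.Layered b h)
    (hF : (2 : F) ≠ 0) : ∀ j ≤ h + 1, T.sqFilt j = T.low (b j) := by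
  intro j
  induction j with
  | zero =>
    intro _
    rw [sqFilt, low, hT.zero, eq_comm, eq_bot_iff]
    rintro _ ⟨v, hv, rfl⟩
    rw [Submodule.mem_bot, show v = 0 from funext fun i => hv i (by omega), map_zero]
  | succ j ih =>
    intro hj
    have hj' : j ≤ h := by omega
    rw [sqFilt, ih (by omega)]
    have hle := hT.mono j hj'
    have hlow : ∀ v ∈ lowVec F n (b j), T.gen v ∈
        Submodule.span F {x | x ∈ T.component 2 ∧ x * x ∈ T.low (b j) * T.low (b j)} :=
      fun v hv => Submodule.subset_span ⟨by rw [component_two]; exact ⟨v, rfl⟩,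
        Submodule.mul_mem_mul (T.gen_mem_low.2 hv) (T.gen_mem_low.2 hv)⟩
    apply le_antisymm
    · rw [Submodule.span_le]
      rintro x ⟨hx, hx2⟩
      rw [component_two] at hx
      obtain ⟨v, rfl⟩ := hx
      refine T.gen_mem_low.2 ?_
      by_cases hv : v ∈ lowVec F n (b j)
      · exact lowVec_mono hle hv
      · obtain ⟨k, h1, h2, a, -, rfl⟩ := hT.exists_sqVec hF hj' hx2 hv
        refine Submodule.smul_mem _ _ (Submodule.sub_mem _ ?_
          (lowVec_mono hle (hT.halfRow_mem hj' h1 h2)))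
        intro i hi
        exact Pi.single_eq_of_ne (by rintro rfl; omega) _
    · rw [low, lowVec_eq_span, Submodule.map_span, Submodule.span_le]
      rintro _ ⟨_, ⟨i, hi, rfl⟩, rfl⟩
      rw [Set.mem_ofPred_eq] at hi
      by_cases h1 : b j ≤ i + 1
      · have : (Pi.single i 1 : Fin n → F) = T.sqVec i + T.halfRow i := by
          rw [sqVec, sub_add_cancel]
        simp only [SetLike.mem_coe]
        rw [this, map_add]
        refine Submodule.add_mem _ (Submodule.subset_span ⟨?_, hT.sqVec_sq_mem hF hj' h1 hi⟩)
          (hlow _ (hT.halfRow_mem hj' h1 hi))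
        rw [component_two]
        exact ⟨_, rfl⟩
      · refine hlow _ fun m hm => Pi.single_eq_of_ne (by rintro rfl; omega) _

/-! ### Invariance -/

lemma map_sqFilt {T S : SLTM F n} (φ : T.NilAlgebra ≃ₐ[F] S.NilAlgebra)
    (hφ : (T.component 2).map φ.toLinearMap = S.component 2) (j : ℕ) :
    (T.sqFilt j).map φ.toLinearMap = S.sqFilt j := by
  induction j with
  | zero => exact Submodule.map_bot _
  | succ j ih =>
    have key : ∀ x : T.NilAlgebra, φ x * φ x ∈ S.sqFilt j * S.sqFilt j ↔
        x * x ∈ T.sqFilt j * T.sqFilt j := by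
      intro x
      have : S.sqFilt j * S.sqFilt j =
          (T.sqFilt j * T.sqFilt j).map φ.toAlgHom.toLinearMap := by
        rw [Submodule.map_mul, ← ih]
        rfl
      rw [this, ← map_mul]
      exact φ.injective.mem_set_image (s := (T.sqFilt j * T.sqFilt j : Submodule F _))
    rw [sqFilt, sqFilt, Submodule.map_span]
    congr 1
    ext y
    constructor
    · rintro ⟨x, ⟨hx, hx2⟩, rfl⟩
      refine ⟨hφ ▸ ⟨x, hx, rfl⟩, (key x).2 hx2⟩
    · rintro ⟨hy, hy2⟩
      rw [← hφ] at hy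
      obtain ⟨x, hx, rfl⟩ := hy
      exact ⟨x, ⟨hx, (key x).1 hy2⟩, rfl⟩

lemma Equivalent.exists_linear {T S : SLTM F n} (h : T.Equivalent S) :
    ∃ (φ : T.NilAlgebra ≃ₐ[F] S.NilAlgebra) (P : (Fin n → F) →ₗ[F] (Fin n → F)),
      (∀ j, (T.sqFilt j).map φ.toLinearMap = S.sqFilt j) ∧ Function.Injective P ∧
      ∀ v, φ (T.gen v) = S.gen (P v) := by
  obtain ⟨φ, hφ⟩ := h
  have hmem : ∀ v, (φ.toLinearMap ∘ₗ T.gen) v ∈ LinearMap.range S.gen := fun v => by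
    rw [← component_two, ← hφ 2]
    exact ⟨T.gen v, by rw [component_two]; exact ⟨v, rfl⟩, rfl⟩
  let P : (Fin n → F) →ₗ[F] (Fin n → F) :=
    (LinearEquiv.ofInjective S.gen S.gen_injective).symm.toLinearMap ∘ₗ
      (φ.toLinearMap ∘ₗ T.gen).codRestrict _ hmem
  have hP : ∀ v, φ (T.gen v) = S.gen (P v) := by
    intro v
    have := (LinearEquiv.ofInjective S.gen S.gen_injective).apply_symm_apply
      ((φ.toLinearMap ∘ₗ T.gen).codRestrict _ hmem v)
    exact (congrArg Subtype.val this).symm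
  refine ⟨φ, P, map_sqFilt φ (hφ 2), fun v w hvw => ?_, hP⟩
  apply T.gen_injective
  apply φ.injective
  rw [hP, hP, hvw]

/-- A dimension count: the two spaces have dimensions `b - 1` and `c - 1`. -/
lemma le_of_lowVec_map {P : (Fin n → F) →ₗ[F] (Fin n → F)} (hP : Function.Injective P) {b c : ℕ}
    (hb : b ≤ n + 1) (hc : 1 ≤ c) (h : ∀ v ∈ lowVec F n b, P v ∈ lowVec F n c) : b ≤ c := by
  by_contra hlt
  let E : (Fin (b - 1) → F) →ₗ[F] (Fin n → F) :=
    { toFun := fun v i => if hi : (i : ℕ) < b - 1 then v ⟨i, hi⟩ else 0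
      map_add' := fun v w => by ext i; by_cases hi : (i : ℕ) < b - 1 <;> simp [hi]
      map_smul' := fun a v => by ext i; by_cases hi : (i : ℕ) < b - 1 <;> simp [hi] }
  let R : (Fin n → F) →ₗ[F] (Fin (c - 1) → F) :=
    LinearMap.funLeft F F (Fin.castLE (by omega))
  have hE : ∀ v, E v ∈ lowVec F n b := fun v i hi => dif_neg (by omega)
  have hinj : Function.Injective (R ∘ₗ P ∘ₗ E) := by
    rw [← LinearMap.ker_eq_bot, LinearMap.ker_eq_bot']
    intro v hv
    have h1 : P (E v) = 0 := by
      funext i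
      by_cases hi : c ≤ i + 1
      · exact h _ (hE v) i hi
      · exact congrFun hv ⟨i, by omega⟩
    have h2 : E v = 0 := hP (h1.trans (map_zero P).symm)
    funext i
    have := congrFun h2 ⟨i, by omega⟩
    simpa [E] using this
  have := LinearMap.finrank_le_finrank_of_injective hinj
  simp only [Module.finrank_fin_fun] at this
  omega

lemma Layered.mem_iff {T S : SLTM F n} {b b' : ℕ → ℕ} {h h' : ℕ} (hT : T.Layered b h)
    (hS : S.Layered b' h') (hF : (2 : F) ≠ 0) {φ : T.NilAlgebra ≃ₐ[F] S.NilAlgebra}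
    {P : (Fin n → F) →ₗ[F] (Fin n → F)}
    (hφ : ∀ j, (T.sqFilt j).map φ.toLinearMap = S.sqFilt j)
    (hP : ∀ v, φ (T.gen v) = S.gen (P v)) {j : ℕ} (hj : j ≤ h + 1) (hj' : j ≤ h' + 1)
    (v : Fin n → F) : P v ∈ lowVec F n (b' j) ↔ v ∈ lowVec F n (b j) := by
  rw [← T.gen_mem_low (b := b j), ← S.gen_mem_low, ← hS.sqFilt_eq hF j hj', ← hT.sqFilt_eq hF j hj, ← hP,
    ← hφ]
  exact φ.injective.mem_set_image (s := (T.sqFilt j : Set _))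

lemma Layered.bound_le {T S : SLTM F n} {b b' : ℕ → ℕ} {h h' : ℕ} (hT : T.Layered b h)
    (hS : S.Layered b' h') (hF : (2 : F) ≠ 0) (hTS : T.Equivalent S) {j : ℕ} (hj : j ≤ h + 1)
    (hj' : j ≤ h' + 1) : b j ≤ b' j := by
  obtain ⟨φ, P, hφ, hinj, hP⟩ := hTS.exists_linear
  refine le_of_lowVec_map hinj ?_ ?_ fun v hv => (hT.mem_iff hS hF hφ hP hj hj' v).2 hv
  · rw [← hT.top]
    exact hT.mono' hj le_rfl
  · rw [← hS.zero]
    exact hS.mono' (Nat.zero_le _) hj'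

lemma Layered.bound_eq {T S : SLTM F n} {b b' : ℕ → ℕ} {h h' : ℕ} (hT : T.Layered b h)
    (hS : S.Layered b' h') (hF : (2 : F) ≠ 0) (hTS : T.Equivalent S) {j : ℕ} (hj : j ≤ h + 1)
    (hj' : j ≤ h' + 1) : b j = b' j :=
  le_antisymm (hT.bound_le hS hF hTS hj hj') (hS.bound_le hT hF hTS.symm hj' hj)

/-- The smaller height reaches the cut `n + 1` at a stage where the other sequence of cuts is still
at most `n`. -/
lemma Layered.height_eq {T S : SLTM F n} {b b' : ℕ → ℕ} {h h' : ℕ} (hT : T.Layered b h)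
    (hS : S.Layered b' h') (hF : (2 : F) ≠ 0) (hTS : T.Equivalent S) : h = h' := by
  rcases lt_trichotomy h h' with hlt | heq | hlt
  · have h1 := hT.bound_eq hS hF hTS (j := h + 1) le_rfl (by omega)
    have h2 := hS.le (j := h + 1) (by omega) (by omega)
    rw [hT.top] at h1
    omega
  · exact heq
  · have h1 := hT.bound_eq hS hF hTS (j := h' + 1) (by omega) le_rfl
    have h2 := hT.le (j := h' + 1) (by omega) (by omega)
    rw [hS.top] at h1
    omega

/-! ### Invariance of measures -/

lemma sqVec_injective {T : SLTM F n} {k l : Fin n} {a b : F} (ha : a ≠ 0) (hb : b ≠ 0)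
    (h : a • T.sqVec k = b • T.sqVec l) : k = l := by
  rcases lt_trichotomy k l with hlt | heq | hlt
  · have := congrFun h l
    simp only [Pi.smul_apply, sqVec_of_lt _ hlt, sqVec_self, smul_eq_mul, mul_zero,
      mul_one] at this
    exact absurd this.symm hb
  · exact heq
  · have := congrFun h k
    simp only [Pi.smul_apply, sqVec_of_lt _ hlt, sqVec_self, smul_eq_mul, mul_zero,
      mul_one] at this
    exact absurd this ha

open Classical in
/-- The number of nonzero entries of a row in the columns `b` to `c - 1`, numbered from one. -/
noncomputable def supportCard (T : SLTM F n) (b c : ℕ) (k : Fin n) : ℕ :=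
  (Finset.univ.filter fun i : Fin n => b ≤ i + 1 ∧ (i : ℕ) + 1 < c ∧ T.1 k i ≠ 0).card

/-- Squares of linear forms only reveal which pairs of distinct coordinates are both nonzero. This
does not distinguish an empty support from a singleton, hence the nonemptiness hypotheses. -/
lemma card_eq_of_pairs {α : Type*} {A B : Finset α} (hA : A.Nonempty) (hB : B.Nonempty)
    (h : ∀ x y, x ≠ y → (x ∈ A ∧ y ∈ A ↔ x ∈ B ∧ y ∈ B)) : A.card = B.card := by
  have key : ∀ {A B : Finset α}, B.Nonempty →
      (∀ x y, x ≠ y → (x ∈ A ∧ y ∈ A ↔ x ∈ B ∧ y ∈ B)) → A.card ≤ B.card := by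
    intro A B hB h
    by_cases h1 : A.card ≤ 1
    · exact h1.trans hB.card_pos
    · refine Finset.card_le_card fun x hx => ?_
      obtain ⟨y, hy, hxy⟩ := Finset.exists_mem_ne (not_le.1 h1) x
      exact ((h x y hxy.symm).1 ⟨hx, hy⟩).1
  exact le_antisymm (key hB h) (key hA fun x y hxy => (h x y hxy).symm)

/-- The isomorphism preserves the filtration, so it maps the line of each completed square to the
line of another one in the same block; this defines the permutation. Comparing the squares of
corresponding half rows then compares their supports in the preceding block. -/
lemma Layered.exists_perm {T S : SLTM F n} {b : ℕ → ℕ} {h : ℕ} (hT : T.Layered b h)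
    (hS : S.Layered b h) (hF : (2 : F) ≠ 0) (hTS : T.Equivalent S) :
    ∃ σ : Equiv.Perm (Fin n),
      (∀ j ≤ h, ∀ k : Fin n, b j ≤ k + 1 → k + 1 < b (j + 1) →
        b j ≤ σ k + 1 ∧ σ k + 1 < b (j + 1)) ∧
      ∀ j < h, ∀ k : Fin n, b (j + 1) ≤ k + 1 → k + 1 < b (j + 2) →
        S.supportCard (b j) (b (j + 1)) (σ k) = T.supportCard (b j) (b (j + 1)) k := by
  obtain ⟨φ, P, hφ, hinj, hP⟩ := hTS.exists_linear
  have hmem := fun j (hj : j ≤ h + 1) => hT.mem_iff hS hF hφ hP hj hj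
  have hsq : ∀ k : Fin n, ∃ l : Fin n, ∃ a : F, a ≠ 0 ∧ P (T.sqVec k) = a • S.sqVec l ∧
      ∀ j ≤ h, b j ≤ k + 1 → k + 1 < b (j + 1) → b j ≤ l + 1 ∧ l + 1 < b (j + 1) := by
    intro k
    obtain ⟨j, -, hj, h1, h2⟩ := hT.exists_block (m := 0) (k := k) (by omega)
      (by rw [hT.zero]; omega)
    have hv : S.gen (P (T.sqVec k)) * S.gen (P (T.sqVec k)) ∈ S.low (b j) * S.low (b j) := by
      have h3 := hT.sqVec_sq_mem hF hj h1 h2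
      rw [← hT.sqFilt_eq hF j (by omega)] at h3
      have h4 : φ.toAlgHom.toLinearMap (T.gen (T.sqVec k) * T.gen (T.sqVec k)) ∈
        (T.sqFilt j * T.sqFilt j).map φ.toAlgHom.toLinearMap := ⟨_, h3, rfl⟩
      rw [Submodule.map_mul] at h4
      rw [← hS.sqFilt_eq hF j (by omega), ← hφ j, ← hP, ← map_mul]
      exact h4
    obtain ⟨l, h3, h4, a, ha, hl⟩ := hS.exists_sqVec hF hj hv
      ((hmem j (by omega) _).not.2 (Layered.sqVec_notMem h1))
    refine ⟨l, a, ha, hl, fun i hi h5 h6 => ?_⟩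
    obtain rfl := hT.block_unique hi hj h5 h6 h1 h2
    exact ⟨h3, h4⟩
  choose s α hα hs hblock using hsq
  have hsinj : Function.Injective s := by
    intro k l hkl
    refine sqVec_injective (T := T) (hα l) (hα k) (hinj ?_)
    rw [map_smul, map_smul, hs, hs, hkl, smul_smul, smul_smul, mul_comm]
  refine ⟨Equiv.ofBijective s (Finite.injective_iff_bijective.1 hsinj),
    fun j hj k h1 h2 => hblock k j hj h1 h2, fun j hj k h1 h2 => ?_⟩
  rw [Equiv.ofBijective_apply]
  -- the coordinates of the image of a vector modulo the preceding layer
  have hcoord : ∀ v ∈ lowVec F n (b (j + 1)), ∀ a : Fin n, b j ≤ a + 1 → a + 1 < b (j + 1) →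
      P v (s a) = α a * v a := by
    intro v hv a ha1 ha2
    obtain ⟨hs1, hs2⟩ := hblock a j hj.le ha1 ha2
    have hterm : ∀ c : Fin n, v c * P (Pi.single c 1) (s a) = if c = a then α a * v a else 0 := by
      intro c
      rcases lt_or_ge ((c : ℕ) + 1) (b j) with hc | hc
      · have h0 : P (Pi.single c 1) (s a) = 0 := (hmem j (by omega) _).2
          (fun i hi => Pi.single_eq_of_ne (by rintro rfl; omega) _) _ hs1
        rw [h0, mul_zero, if_neg (by rintro rfl; omega)]
      · rcases lt_or_ge ((c : ℕ) + 1) (b (j + 1)) with hc' | hc'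
        -- The half row lies in the lower layer and its image stays there, so only the image of the
        -- completed square contributes.
        · have h3 : (Pi.single c 1 : Fin n → F) = T.sqVec c + T.halfRow c := by
            rw [sqVec, sub_add_cancel]
          have h0 : P (T.halfRow c) (s a) = 0 :=
            (hmem j (by omega) _).2 (hT.halfRow_mem hj.le hc hc') _ hs1
          obtain ⟨hc1, hc2⟩ := hblock c j hj.le hc hc'
          have h5 : S.halfRow (s c) (s a) = 0 := hS.halfRow_mem hj.le hc1 hc2 _ hs1
          rw [h3, map_add, hs, Pi.add_apply, h0, add_zero, Pi.smul_apply, sqVec, Pi.sub_apply, h5,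
            sub_zero, smul_eq_mul]
          by_cases hca : c = a
          · subst hca
            simp [mul_comm]
          · rw [if_neg hca, Pi.single_eq_of_ne (fun h => hca (hsinj h.symm)), mul_zero, mul_zero]
        · rw [hv c hc', zero_mul, if_neg (by rintro rfl; omega)]
    conv_lhs => rw [pi_eq_sum_univ' v, map_sum, Finset.sum_apply]
    simp only [map_smul, Pi.smul_apply, smul_eq_mul, hterm]
    simp
  have hlow := hT.halfRow_mem (by omega) h1 h2
  have hlow' := hS.halfRow_mem (by omega) (hblock k _ (by omega) h1 h2).1
    (hblock k _ (by omega) h1 h2).2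
  have hsquare : S.gen (P (T.halfRow k)) * S.gen (P (T.halfRow k)) =
      (α k * α k) • (S.gen (S.halfRow (s k)) * S.gen (S.halfRow (s k))) := by
    rw [← hP, ← map_mul, ← gen_sqVec_sq hF, map_mul, hP, hs, map_smul, smul_mul_smul_comm,
      gen_sqVec_sq hF]
  have hlt : ∀ i i' : Fin n, i < i' → b j ≤ i + 1 → i' + 1 < b (j + 1) →
      P (T.halfRow k) i * P (T.halfRow k) i' =
        α k * α k * (S.halfRow (s k) i * S.halfRow (s k) i') := by
    intro i i' hii h3 h4
    have h5 := congrArg (S.coef hii) hsquare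
    have hii' : (i : ℕ) < i' := hii
    -- Rows of a block have no entries in columns of the same block, so the coefficient of `X_i
    -- X_{i'}` in a square is a bare product of two coordinates, up to a constant.
    have h6 : S.1 i' i = 0 := hS.row j hj.le i' (by omega) h4 i h3
    rw [map_smul, coef_gen_mul, coef_gen_mul, h6, smul_eq_mul] at h5
    have h7 : (2 * 2 : F) * (P (T.halfRow k) i * P (T.halfRow k) i' -
        α k * α k * (S.halfRow (s k) i * S.halfRow (s k) i')) = 0 := by
      linear_combination h5
    exact sub_eq_zero.1 ((mul_eq_zero.1 h7).resolve_left (mul_ne_zero hF hF))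
  have hhalf : ∀ (R : SLTM F n) (x y : Fin n), R.halfRow x y ≠ 0 ↔ R.1 x y ≠ 0 := by
    intro R x y
    simp [halfRow, hF]
  have hpair : ∀ a a' : Fin n, a ≠ a' → b j ≤ a + 1 → a + 1 < b (j + 1) → b j ≤ a' + 1 →
      a' + 1 < b (j + 1) → ((T.1 k a ≠ 0 ∧ T.1 k a' ≠ 0) ↔
        (S.1 (s k) (s a) ≠ 0 ∧ S.1 (s k) (s a') ≠ 0)) := by
    intro a a' haa h3 h4 h5 h6
    have heq : P (T.halfRow k) (s a) * P (T.halfRow k) (s a') =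
        α k * α k * (S.halfRow (s k) (s a) * S.halfRow (s k) (s a')) := by
      rcases lt_or_gt_of_ne (hsinj.ne haa) with hlt' | hlt'
      · exact hlt _ _ hlt' (hblock a j hj.le h3 h4).1 (hblock a' j hj.le h5 h6).2
      · rw [mul_comm, mul_comm (S.halfRow (s k) (s a))]
        exact hlt _ _ hlt' (hblock a' j hj.le h5 h6).1 (hblock a j hj.le h3 h4).2
    rw [hcoord _ hlow a h3 h4, hcoord _ hlow a' h5 h6] at heq
    rw [← hhalf T, ← hhalf T, ← hhalf S, ← hhalf S, ← mul_ne_zero_iff, ← mul_ne_zero_iff]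
    have e1 : (α a * α a') * (T.halfRow k a * T.halfRow k a') =
        α k * α k * (S.halfRow (s k) (s a) * S.halfRow (s k) (s a')) := by
      linear_combination heq
    constructor
    · intro h0 h0'
      rw [h0', mul_zero] at e1
      exact mul_ne_zero (mul_ne_zero (hα a) (hα a')) h0 e1
    · intro h0 h0'
      rw [h0', mul_zero] at e1
      exact mul_ne_zero (mul_ne_zero (hα k) (hα k)) h0 e1.symm
  have hsurj : ∀ i : Fin n, b j ≤ i + 1 → i + 1 < b (j + 1) →
      ∃ a : Fin n, s a = i ∧ b j ≤ a + 1 ∧ a + 1 < b (j + 1) := by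
    intro i hi1 hi2
    obtain ⟨a, rfl⟩ := (Finite.injective_iff_surjective.1 hsinj) i
    obtain ⟨m, -, hm, h3, h4⟩ := hT.exists_block (m := 0) (k := a) (by omega)
      (by rw [hT.zero]; omega)
    obtain ⟨h5, h6⟩ := hblock a m hm h3 h4
    obtain rfl := hT.block_unique hm hj.le h5 h6 hi1 hi2
    exact ⟨a, rfl, h3, h4⟩
  classical
  set A := Finset.univ.filter fun a : Fin n => b j ≤ a + 1 ∧ a + 1 < b (j + 1) ∧ T.1 k a ≠ 0
    with hA
  -- The support of row `s k` of `S`, pulled back along `s` to be comparable with `A`.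
  set B := Finset.univ.filter fun a : Fin n =>
    b j ≤ a + 1 ∧ a + 1 < b (j + 1) ∧ S.1 (s k) (s a) ≠ 0 with hB
  have hAB : A.card = B.card := by
    refine card_eq_of_pairs ?_ ?_ ?_
    · obtain ⟨c, hc, hc0, -⟩ := hT.delta j hj k h1 h2
      refine ⟨c, ?_⟩
      rw [hA, Finset.mem_filter]
      refine ⟨Finset.mem_univ _, hc, ?_, hc0⟩
      by_contra hlt
      exact hc0 (hT.row (j + 1) hj k h1 h2 c (not_lt.1 hlt))
    · obtain ⟨h3, h4⟩ := hblock k (j + 1) hj h1 h2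
      obtain ⟨c, hc, hc0, -⟩ := hS.delta j hj (s k) h3 h4
      have hc' : c + 1 < b (j + 1) := by
        by_contra hlt
        exact hc0 (hS.row (j + 1) hj (s k) h3 h4 c (not_lt.1 hlt))
      obtain ⟨a, rfl, ha1, ha2⟩ := hsurj c hc hc'
      refine ⟨a, ?_⟩
      rw [hB, Finset.mem_filter]
      exact ⟨Finset.mem_univ _, ha1, ha2, hc0⟩
    · intro x y hxy
      simp only [hA, hB, Finset.mem_filter, Finset.mem_univ, true_and]
      constructor
      · rintro ⟨⟨x1, x2, x3⟩, y1, y2, y3⟩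
        have := (hpair x y hxy x1 x2 y1 y2).1 ⟨x3, y3⟩
        exact ⟨⟨x1, x2, this.1⟩, y1, y2, this.2⟩
      · rintro ⟨⟨x1, x2, x3⟩, y1, y2, y3⟩
        have := (hpair x y hxy x1 x2 y1 y2).2 ⟨x3, y3⟩
        exact ⟨⟨x1, x2, this.1⟩, y1, y2, this.2⟩
  have hBS : S.supportCard (b j) (b (j + 1)) (s k) = B.card := by
    rw [supportCard, ← Finset.card_image_of_injective B hsinj]
    congr 1
    ext i
    simp only [hB, Finset.mem_filter, Finset.mem_univ, true_and, Finset.mem_image]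
    constructor
    · rintro ⟨i1, i2, i3⟩
      obtain ⟨a, rfl, ha1, ha2⟩ := hsurj i i1 i2
      exact ⟨a, ⟨ha1, ha2, i3⟩, rfl⟩
    · rintro ⟨a, ⟨ha1, ha2, ha3⟩, rfl⟩
      obtain ⟨h3, h4⟩ := hblock a j hj.le ha1 ha2
      exact ⟨h3, h4, ha3⟩
  rw [hBS, ← hAB, supportCard]

/-! ### Numbering from one -/

lemma entry_succ (T : SLTM F n) (i j : Fin n) : T.entry (i + 1) (j + 1) = T.1 i j := by
  rw [entry, dif_pos (by omega)]
  rfl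

lemma entry_eq_zero (T : SLTM F n) {r c : ℕ} (h : c = 0 ∨ n < c) : T.entry r c = 0 :=
  dif_neg (by omega)

lemma exists_fin_of_pos {r : ℕ} (h1 : 1 ≤ r) (h2 : r ≤ n) : ∃ k : Fin n, r = k + 1 :=
  ⟨⟨r - 1, by omega⟩, by simp only; omega⟩

lemma rowZero_succ (T : SLTM F n) (k : Fin n) : T.RowZero (k + 1) ↔ T.1 k = 0 := by
  constructor
  · intro h
    funext i
    rw [← entry_succ]
    exact h _ (by omega) (by omega)
  · intro h c h1 h2
    obtain ⟨i, rfl⟩ := exists_fin_of_pos h1 h2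
    rw [entry_succ, h]
    rfl

lemma lead_succ_lt (T : SLTM F n) (k : Fin n) {b : ℕ} (hb : 1 ≤ b) :
    T.lead (k + 1) < b ↔ T.1 k ∈ lowVec F n b := by
  classical
  rw [lead, Finset.sup_lt_iff (Nat.lt_of_lt_of_le Nat.zero_lt_one hb)]
  constructor
  · intro h i hi
    by_contra h0
    have := h (i + 1) (by
      rw [Finset.mem_filter, Finset.mem_Icc, entry_succ]
      exact ⟨by omega, h0⟩)
    simp only [id_eq] at this
    omega
  · intro h c hc
    rw [Finset.mem_filter, Finset.mem_Icc] at hc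
    obtain ⟨i, rfl⟩ := exists_fin_of_pos hc.1.1 hc.1.2
    rw [entry_succ] at hc
    by_contra hlt
    exact hc.2 (h i (not_lt.1 hlt))

lemma lead_succ_eq_zero (T : SLTM F n) (k : Fin n) : T.lead (k + 1) = 0 ↔ T.1 k = 0 := by
  have : T.lead (k + 1) = 0 ↔ T.lead (k + 1) < 1 := by omega
  rw [this, lead_succ_lt _ _ le_rfl]
  exact ⟨fun h => funext fun i => h i (by omega), fun h i _ => congrFun h i⟩

lemma lead_succ_le (T : SLTM F n) (k : Fin n) : T.lead (k + 1) < k + 1 :=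
  (T.lead_succ_lt k (by omega)).2 fun i hi => T.2 k i (Fin.le_def.2 (by omega))

lemma lead_succ_eq (T : SLTM F n) {k c : Fin n} (h : T.1 k c ≠ 0) (h' : ∀ i > c, T.1 k i = 0) :
    T.lead (k + 1) = c + 1 := by
  have h1 : T.lead (k + 1) < c + 2 :=
    (T.lead_succ_lt k (by omega)).2 fun i hi => h' i (Fin.lt_def.2 (by omega))
  have h2 : ¬ T.lead (k + 1) < c + 1 := fun hlt => h ((T.lead_succ_lt k (by omega)).1 hlt c le_rfl)
  omega

lemma exists_lead (T : SLTM F n) {k : Fin n} (h : T.1 k ≠ 0) :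
    ∃ c : Fin n, T.1 k c ≠ 0 ∧ (∀ i > c, T.1 k i = 0) ∧ T.lead (k + 1) = c + 1 := by
  classical
  obtain ⟨i, hi⟩ := Function.ne_iff.1 h
  obtain ⟨c, hc⟩ := Finset.exists_max_image (Finset.univ.filter fun i : Fin n => T.1 k i ≠ 0) id
    ⟨i, by simpa using hi⟩
  simp only [Finset.mem_filter, Finset.mem_univ, true_and, id_eq] at hc
  have h2 : ∀ i > c, T.1 k i = 0 := fun i hi => by
    by_contra h0
    exact absurd (hc.2 i h0) (not_le.2 hi)
  exact ⟨c, hc.1, h2, T.lead_succ_eq hc.1 h2⟩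

/-- The `k`-th row has a leader, in a column `c`, and the element `X_i X_c` occurs in the square of
the corresponding linear form for some `i < c`. -/
def StrongRow (T : SLTM F n) (k : Fin n) : Prop :=
  ∃ c : Fin n, T.1 k c ≠ 0 ∧ (∀ i > c, T.1 k i = 0) ∧
    ∃ i < c, 2 * T.1 k i + T.1 k c * T.1 c i ≠ 0

lemma strongRow_iff (T : SLTM F n) (k : Fin n) (hk : T.1 k ≠ 0) : T.StrongRow k ↔
    1 < T.lead (k + 1) ∧ ∃ i : ℕ, 1 ≤ i ∧ i < T.lead (k + 1) ∧
      T.Delta 2 i (T.lead (k + 1)) (k + 1) ≠ 0 := by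
  constructor
  · rintro ⟨c, h1, h2, i, hi, hd⟩
    rw [T.lead_succ_eq h1 h2]
    have : (i : ℕ) < c := hi
    refine ⟨by omega, i + 1, by omega, by omega, ?_⟩
    rwa [Delta, entry_succ, entry_succ, entry_succ]
  · rintro ⟨-, i, h1, h2, hd⟩
    obtain ⟨c, h3, h4, h5⟩ := T.exists_lead hk
    rw [h5] at h2 hd
    obtain ⟨i, rfl⟩ := exists_fin_of_pos (n := n) h1 (by omega)
    rw [Delta, entry_succ, entry_succ, entry_succ] at hd
    exact ⟨c, h3, h4, i, Fin.lt_def.2 (by omega), hd⟩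

lemma rowMeasure_succ (T : SLTM F n) {b c : ℕ} (k : Fin n) (hb : 1 ≤ b) :
    T.rowMeasure b c (k + 1) = T.supportCard b c k := by
  classical
  rw [rowMeasure, supportCard,
    ← Finset.card_image_of_injective _ (f := fun i : Fin n => (i : ℕ) + 1)
      fun i j h => Fin.ext (Nat.succ_injective h)]
  congr 1
  ext r
  simp only [Finset.mem_filter, Finset.mem_Ico, Finset.mem_image, Finset.mem_univ, true_and]
  constructor
  · rintro ⟨⟨h1, h2⟩, h3⟩
    have hr : r ≤ n := by
      by_contra hlt
      exact h3 (T.entry_eq_zero (Or.inr (not_le.1 hlt)))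
    obtain ⟨i, rfl⟩ := exists_fin_of_pos (hb.trans h1) hr
    rw [entry_succ] at h3
    exact ⟨i, ⟨h1, h2, h3⟩, rfl⟩
  · rintro ⟨i, ⟨h1, h2, h3⟩, rfl⟩
    rw [entry_succ]
    exact ⟨⟨h1, h2⟩, h3⟩

/-! ### Greedy chains -/

/-- Appending `N + 1` expresses that the last member has no successor in the same form as the
minimality of the other steps. -/
lemma greedyChain_spec (P : ℕ → ℕ → Prop) (N r : ℕ) (hr : r ≤ N) :
    (greedyChain P N r).head? = some r ∧ ∀ j < (greedyChain P N r).length,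
      (greedyChain P N r ++ [N + 1]).getD j 0 < (greedyChain P N r ++ [N + 1]).getD (j + 1) 0 ∧
      (∀ s, (greedyChain P N r ++ [N + 1]).getD j 0 < s →
        s < (greedyChain P N r ++ [N + 1]).getD (j + 1) 0 →
        ¬ P ((greedyChain P N r ++ [N + 1]).getD j 0) s) ∧
      (j + 1 < (greedyChain P N r).length → P ((greedyChain P N r ++ [N + 1]).getD j 0)
        ((greedyChain P N r ++ [N + 1]).getD (j + 1) 0)) := by
  classical
  induction hm : N - r using Nat.strong_induction_on generalizing r with
  | _ m ih =>
    rw [greedyChain]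
    split_ifs with h
    · have h1 := Finset.min'_mem _ h
      have h2 := fun x hx => Finset.min'_le ((Finset.Ioc r N).filter (P r)) x hx
      set s := ((Finset.Ioc r N).filter (P r)).min' h with hs
      simp only [Finset.mem_filter, Finset.mem_Ioc] at h1 h2
      obtain ⟨ih1, ih2⟩ := ih (N - s) (by omega) s h1.1.2 rfl
      have h0 : (greedyChain P N s ++ [N + 1]).getD 0 0 = s := by
        cases hl : greedyChain P N s with
        | nil => rw [hl] at ih1; simp at ih1
        | cons a l => rw [hl] at ih1; simpa using ih1
      refine ⟨rfl, fun j hj => ?_⟩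
      rw [List.cons_append]
      cases j with
      | zero =>
        rw [List.getD_cons_zero, List.getD_cons_succ, h0]
        refine ⟨h1.1.1, fun x hx1 hx2 hP => ?_, fun _ => h1.2⟩
        have := h2 x ⟨⟨hx1, by omega⟩, hP⟩
        omega
      | succ j =>
        rw [List.getD_cons_succ, List.getD_cons_succ]
        rw [List.length_cons] at hj ⊢
        obtain ⟨e1, e2, e3⟩ := ih2 j (by omega)
        exact ⟨e1, e2, fun h => e3 (by omega)⟩
    · refine ⟨rfl, fun j hj => ?_⟩
      simp only [List.length_cons, List.length_nil] at hj
      obtain rfl : j = 0 := by omega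
      simp only [List.cons_append, List.nil_append, List.getD_cons_zero, List.getD_cons_succ]
      refine ⟨by omega, fun s h1 h2 hP => h ⟨s, ?_⟩, by simp⟩
      simp only [Finset.mem_filter, Finset.mem_Ioc]
      exact ⟨by omega, hP⟩

lemma greedyChain_map_congr {α : Type*} {P Q : ℕ → ℕ → Prop} {f g : ℕ → α} (N r : ℕ) (hr : r ≤ N)
    (hPQ : ∀ s t, r ≤ s → s ≤ N → r ≤ t → t ≤ N → (P s t ↔ Q s t))
    (hfg : ∀ s, r ≤ s → s ≤ N → f s = g s) :
    (greedyChain P N r).map f = (greedyChain Q N r).map g := by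
  classical
  induction hm : N - r using Nat.strong_induction_on generalizing r with
  | _ m ih =>
    have hset : (Finset.Ioc r N).filter (P r) = (Finset.Ioc r N).filter (Q r) := by
      refine Finset.filter_congr fun s hs => ?_
      rw [Finset.mem_Ioc] at hs
      exact hPQ r s le_rfl hr hs.1.le hs.2
    rw [greedyChain, greedyChain]
    simp only [hset]
    split_ifs with hne
    · have h1 := Finset.min'_mem _ hne
      simp only [Finset.mem_filter, Finset.mem_Ioc] at h1
      rw [List.map_cons, List.map_cons, hfg r le_rfl hr,
        ih _ (by omega) _ h1.1.2 (fun s t hs h2 ht => hPQ s t (by omega) h2 (by omega))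
          (fun s hs => hfg s (by omega)) rfl]
    · simp [hfg r le_rfl hr]

/-! ### The layers of a matrix in first reduced echelon form -/

/-- The numbers `1`, the entries of `L`, and `n + 1`. -/
def cut (n : ℕ) (L : List ℕ) (j : ℕ) : ℕ := (1 :: (L ++ [n + 1])).getD j 0

lemma cut_zero (L : List ℕ) : cut n L 0 = 1 := rfl

lemma cut_succ (L : List ℕ) (j : ℕ) : cut n L (j + 1) = (L ++ [n + 1]).getD j 0 := rfl

lemma cut_top (L : List ℕ) : cut n L (L.length + 1) = n + 1 := by
  rw [cut_succ]
  simp [List.getD]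

lemma cut_injective {L L' : List ℕ} (hl : L.length = L'.length)
    (h : ∀ j ≤ L.length, cut n L j = cut n L' j) : L = L' := by
  refine List.ext_getElem hl fun i h1 h2 => ?_
  have := h (i + 1) (by omega)
  rw [cut_succ, cut_succ] at this
  simpa [List.getD, h1, h2, List.getElem?_append_left] using this

/-- The conventional wall `(0)` of the zero matrix does not cut the rows; its layering has the empty
list of cuts and a single block. -/
lemma layered_zero : (0 : SLTM F n).Layered (cut n []) 0 where
  zero := rfl
  top := rfl
  mono := fun j hj => by
    obtain rfl : j = 0 := by omega
    exact Nat.le_add_left 1 n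
  lt := fun j h1 h2 => by omega
  row := fun _ _ _ _ _ _ _ => rfl
  delta := fun j hj => by omega

lemma exists_row_ne_zero {T : SLTM F n} (h : T ≠ 0) : ∃ k : Fin n, T.1 k ≠ 0 := by
  by_contra! h'
  exact h (Subtype.ext (funext h'))

/-- The greedy rule bounds the leaders in a block from above by its first row. Monotonicity of the
leaders bounds them from below, since the first row of the block already has its leader at or beyond
the previous cut. -/
lemma IsFirstREF.layered {T : SLTM F n} (hT : T.IsFirstREF) (h0 : T ≠ 0) :
    T.Layered (cut n T.firstWall) T.firstWall.length ∧ T.firstWall ≠ [] ∧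
      ∀ k : Fin n, T.1 k ≠ 0 → T.StrongRow k := by
  classical
  obtain ⟨hz, hstrong, hmono⟩ := hT.resolve_left h0
  have hstrong' : ∀ k : Fin n, T.1 k ≠ 0 → T.StrongRow k := fun k hk =>
    (T.strongRow_iff k hk).2 (hstrong _ (by omega) (by omega) ((T.rowZero_succ k).not.2 hk))
  have hne : ((Finset.Icc 1 n).filter (fun r => ¬ T.RowZero r)).Nonempty := by
    obtain ⟨k, hk⟩ := exists_row_ne_zero h0
    refine ⟨k + 1, ?_⟩
    rw [Finset.mem_filter, Finset.mem_Icc, rowZero_succ]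
    exact ⟨by omega, hk⟩
  have h1 := Finset.min'_mem _ hne
  have h2 := fun x hx => Finset.min'_le ((Finset.Icc 1 n).filter (fun r => ¬ T.RowZero r)) x hx
  have hL : T.firstWall = greedyChain (fun r s => r ≤ T.lead s) n
      (((Finset.Icc 1 n).filter (fun r => ¬ T.RowZero r)).min' hne) := by
    rw [firstWall, dif_pos hne]
  set r := ((Finset.Icc 1 n).filter (fun r => ¬ T.RowZero r)).min' hne with hr
  simp only [Finset.mem_filter, Finset.mem_Icc] at h1 h2
  obtain ⟨hhead, hspec⟩ := greedyChain_spec (fun r s => r ≤ T.lead s) n r h1.1.2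
  rw [← hL] at hhead hspec
  set L := T.firstWall
  have hnil : L ≠ [] := by
    intro h
    rw [h] at hhead
    simp at hhead
  have hcut1 : cut n L 1 = r := by
    rw [cut_succ]
    cases hl : L with
    | nil => exact absurd hl hnil
    | cons a l => rw [hl] at hhead; simpa using hhead
  have hlt : ∀ j, 1 ≤ j → j ≤ L.length → cut n L j < cut n L (j + 1) := by
    intro j hj1 hj2
    obtain ⟨j, rfl⟩ : ∃ i, j = i + 1 := ⟨j - 1, by omega⟩
    exact (hspec j (by omega)).1
  have hmono' : ∀ j ≤ L.length, cut n L j ≤ cut n L (j + 1) := by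
    intro j hj
    cases j with
    | zero => rw [cut_zero, hcut1]; exact h1.1.1
    | succ j => exact (hlt _ (by omega) hj).le
  have hr_le : ∀ j, j ≤ L.length → r ≤ cut n L (j + 1) := by
    intro j
    induction j with
    | zero => intro _; exact hcut1.ge
    | succ j ih => intro hj; exact (ih (by omega)).trans (hmono' _ hj)
  have hnz : ∀ k : Fin n, r ≤ k + 1 → T.1 k ≠ 0 := by
    intro k hk h
    have := hz (k + 1) r (by omega) (by omega) h1.1.1 h1.1.2 ((T.rowZero_succ k).2 h) h1.2
    omega
  have hleadmono : ∀ s t : ℕ, r ≤ s → s ≤ t → t ≤ n → T.lead s ≤ T.lead t := by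
    intro s t hs hst
    induction t, hst using Nat.le_induction with
    | base => exact fun _ => le_rfl
    | succ t hst ih =>
      intro ht
      refine (ih (by omega)).trans (hmono t (by omega) ht ?_ ?_)
      · obtain ⟨k, rfl⟩ := exists_fin_of_pos (n := n) (r := t) (by omega) (by omega)
        exact (T.rowZero_succ k).not.2 (hnz k (by omega))
      · obtain ⟨k, hk⟩ := exists_fin_of_pos (n := n) (r := t + 1) (by omega) (by omega)
        rw [hk]
        exact (T.rowZero_succ k).not.2 (hnz k (by omega))
  refine ⟨⟨rfl, cut_top L, hmono', hlt, ?_, ?_⟩, hnil, hstrong'⟩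
  · intro j hj k hk1 hk2
    cases j with
    | zero =>
      rw [hcut1] at hk2
      have hk : T.1 k = 0 := by
        by_contra h
        have := h2 (k + 1) ⟨by omega, (T.rowZero_succ k).not.2 h⟩
        omega
      exact fun i _ => congrFun hk i
    | succ j =>
      have hj1 : 1 ≤ cut n L (j + 1) := h1.1.1.trans (hr_le j (by omega))
      rw [← lead_succ_lt _ _ hj1]
      -- The greedy rule says nothing about the first row of a block; there strict triangularity
      -- gives the bound.
      rcases hk1.eq_or_lt with heq | hlt'
      · rw [heq]
        exact T.lead_succ_le k
      · exact not_le.1 ((hspec j (by omega)).2.1 _ hlt' hk2)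
  · intro j hj k hk1 hk2
    have hk := hnz k ((hr_le j hj.le).trans hk1)
    obtain ⟨c, hc1, hc2, hc3⟩ := hstrong' k hk
    refine ⟨c, ?_, hc1, hc3⟩
    rw [← T.lead_succ_eq hc1 hc2]
    cases j with
    | zero =>
      rw [T.lead_succ_eq hc1 hc2, cut_zero]
      omega
    | succ j =>
      refine ((hspec j (by omega)).2.2 hj).trans (hleadmono _ _ (hr_le _ hj.le) hk1 (by omega))

lemma Layered.list_eq {T S : SLTM F n} {L L' : List ℕ} (hT : T.Layered (cut n L) L.length)
    (hS : S.Layered (cut n L') L'.length) (hF : (2 : F) ≠ 0) (hTS : T.Equivalent S) : L = L' := by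
  have hl := hT.height_eq hS hF hTS
  exact cut_injective hl fun j hj => hT.bound_eq hS hF hTS (by omega) (by omega)

lemma IsFirstREF.not_equivalent_zero {T : SLTM F n} (hT : T.IsFirstREF) (h0 : T ≠ 0)
    (hF : (2 : F) ≠ 0) : ¬ T.Equivalent 0 := fun h =>
  (hT.layered h0).2.1 ((hT.layered h0).1.list_eq layered_zero hF h)

lemma IsFirstREF.firstWall_eq {T S : SLTM F n} (hT : T.IsFirstREF) (hS : S.IsFirstREF)
    (hF : (2 : F) ≠ 0) (h : T.Equivalent S) : T.firstWall = S.firstWall := by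
  by_cases hT0 : T = 0
  · by_cases hS0 : S = 0
    · rw [hT0, hS0]
    · exact absurd (hT0 ▸ h.symm) (hS.not_equivalent_zero hS0 hF)
  · by_cases hS0 : S = 0
    · exact absurd (hS0 ▸ h) (hT.not_equivalent_zero hT0 hF)
    · exact (hT.layered hT0).1.list_eq (hS.layered hS0).1 hF h

lemma wall_eq {T R : SLTM F n} (hF : (2 : F) ≠ 0) (hR : R.IsFirstREF) (h : T.Equivalent R) :
    T.wall = R.firstWall := by
  have hex : ∃ R : SLTM F n, R.IsFirstREF ∧ T.Equivalent R := ⟨R, hR, h⟩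
  rw [wall, dif_pos hex]
  exact hex.choose_spec.1.firstWall_eq hR hF (hex.choose_spec.2.symm.trans h)

/-! ### Elementary operations -/

/-- The linear map fixing all basis vectors except the `k`-th one, to which it adds `d`. -/
def shear (k : Fin n) (d : Fin n → F) : (Fin n → F) →ₗ[F] (Fin n → F) :=
  LinearMap.id + (LinearMap.proj k : (Fin n → F) →ₗ[F] F).smulRight d

lemma shear_apply (k : Fin n) (d v : Fin n → F) : shear k d v = v + v k • d := by
  simp [shear]

lemma shear_single_self (k : Fin n) (d : Fin n → F) :
    shear k d (Pi.single k 1) = Pi.single k 1 + d := by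
  simp [shear_apply]

lemma shear_single_of_ne {k i : Fin n} (h : i ≠ k) (d : Fin n → F) :
    shear k d (Pi.single i 1) = Pi.single i 1 := by
  simp [shear_apply, Pi.single_eq_of_ne h.symm]

lemma shear_shear (k : Fin n) {d : Fin n → F} (hd : d k = 0) (v : Fin n → F) :
    shear k d (shear k (-d) v) = v := by
  simp [shear_apply, hd]

lemma shear_shear' (k : Fin n) {d : Fin n → F} (hd : d k = 0) (v : Fin n → F) :
    shear k (-d) (shear k d v) = v := by
  simp [shear_apply, hd]

/-- With `w = y - z` and `y w = 0`, the product is `(x + l w)(x - l y) = x (x - l z) - l² y w`. -/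
lemma mul_shear_eq_zero {A : Type*} [CommRing A] [Algebra F A] {x y z : A} (l : F)
    (h1 : x * (x - l • z) = 0) (h2 : y * (y - z) = 0) :
    (x + l • (y - z)) * (x + l • (y - z) - l • (y + (y - z))) = 0 := by
  simp only [Algebra.smul_def] at h1 ⊢
  linear_combination h1 - (algebraMap F A l) ^ 2 * h2

lemma mul_shear_neg_eq_zero {A : Type*} [CommRing A] [Algebra F A] {x y z : A} (l : F)
    (h1 : x * (x - l • (y + (y - z))) = 0) (h2 : y * (y - z) = 0) :
    (x + -(l • (y - z))) * (x + -(l • (y - z)) - l • z) = 0 := by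
  simp only [Algebra.smul_def] at h1 ⊢
  linear_combination h1 + (algebraMap F A l) ^ 2 * h2

/-- If the square of the form of the `k`-th row has no term `X_i X_c` with `i < c` its last column,
then the leader of the row can be moved to the left. -/
lemma exists_lead_lt (hF : (2 : F) ≠ 0) (T : SLTM F n) {k c : Fin n} (hkc : T.1 k c ≠ 0)
    (hc : ∀ i > c, T.1 k i = 0) (hd : ∀ i < c, 2 * T.1 k i + T.1 k c * T.1 c i = 0) :
    ∃ S : SLTM F n, T.Equivalent S ∧ (∀ i < k, S.1 i = T.1 i) ∧ ∀ i, c ≤ i → S.1 k i = 0 := by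
  have hck : c < k := by
    by_contra h
    exact hkc (T.2 k c (not_lt.1 h))
  obtain ⟨l, hl⟩ : ∃ l : F, T.1 k c = 2 * l := ⟨T.1 k c / 2, by field_simp⟩
  set d : Fin n → F := l • (Pi.single c 1 - T.1 c) with hdef
  have hdk : ∀ i, k ≤ i → d i = 0 := fun i hi => by
    simp [hdef, T.2 c i (hck.le.trans hi), Pi.single_eq_of_ne (hck.trans_le hi).ne']
  -- The vanishing of all `Δ` at the leader says that row `k` is a multiple of `X_c + (X_c - T_c)`,
  -- a sum of two forms with product zero. Translating `X_k` by a multiple of the second form leaves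
  -- the row `l T_c`, which ends before column `c`.
  have hrow : T.1 k = l • (Pi.single c 1 + (Pi.single c 1 - T.1 c)) := by
    funext i
    rcases lt_trichotomy i c with hi | rfl | hi
    · have h1 := hd i hi
      rw [hl] at h1
      have h2 : T.1 k i + l * T.1 c i = 0 := by
        refine (mul_eq_zero.1 (?_ : 2 * (T.1 k i + l * T.1 c i) = 0)).resolve_left hF
        linear_combination h1
      simp only [Pi.smul_apply, Pi.add_apply, Pi.sub_apply, Pi.single_eq_of_ne hi.ne, smul_eq_mul]
      linear_combination h2
    · simp only [Pi.smul_apply, Pi.add_apply, Pi.sub_apply, Pi.single_eq_same, smul_eq_mul,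
        T.2 i i le_rfl, hl]
      ring
    · simp [hc i hi, T.2 c i hi.le, Pi.single_eq_of_ne hi.ne']
  -- Rows after the `k`-th are rewritten in the new generator; those before it do not involve `X_k`.
  let S : SLTM F n := ⟨fun i => if i = k then l • T.1 c else shear k d (T.1 i), by
    intro i j hij
    by_cases hik : i = k
    · subst hik
      simp [T.2 c j (hck.le.trans hij)]
    · simp only [hik, if_false, shear_apply, Pi.add_apply, Pi.smul_apply, T.2 i j hij, zero_add,
        smul_eq_mul]
      rcases le_or_gt i k with h | h
      · rw [T.2 i k h, zero_mul]
      · rw [hdk j (h.le.trans hij), mul_zero]⟩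
  have hSk : S.1 k = l • T.1 c := if_pos rfl
  have hSi : ∀ i, i ≠ k → S.1 i = shear k d (T.1 i) := fun i hi => if_neg hi
  have hSlt : ∀ i < k, S.1 i = T.1 i := fun i hi => by
    rw [hSi i hi.ne, shear_apply, T.2 i k hi.le, zero_smul, add_zero]
  refine ⟨S, ?_, hSlt, ?_⟩
  · refine equivalent_of_linear (shear k d) (shear k (-d)) (shear_shear k (hdk k le_rfl))
      (shear_shear' k (hdk k le_rfl)) (fun i => ?_) fun i => ?_
    · by_cases hik : i = k
      · subst hik
        have e1 : shear i d (T.1 i) = T.1 i := by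
          rw [shear_apply, T.2 i i le_rfl, zero_smul, add_zero]
        have r1 := S.gen_rel i
        have r2 := S.gen_rel c
        rw [hSlt c hck] at r2
        rw [hSk, map_smul] at r1
        rw [shear_single_self, e1, hrow]
        simp only [hdef, map_add, map_sub, map_smul]
        exact mul_shear_eq_zero l r1 r2
      · rw [shear_single_of_ne hik, ← hSi i hik]
        exact S.gen_rel i
    · by_cases hik : i = k
      · subst hik
        have e1 : shear i (-d) (S.1 i) = S.1 i := by
          rw [shear_apply, S.2 i i le_rfl, zero_smul, add_zero]
        have r1 := T.gen_rel i
        have r2 := T.gen_rel c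
        rw [hrow] at r1
        rw [shear_single_self, e1, hSk]
        simp only [hdef, map_add, map_sub, map_smul, map_neg] at r1 ⊢
        exact mul_shear_neg_eq_zero l r1 r2
      · rw [shear_single_of_ne hik, hSi i hik, shear_shear' k (hdk k le_rfl)]
        exact T.gen_rel i
  · intro i hi
    rw [hSk, Pi.smul_apply, T.2 c i hi, smul_zero]

/-- Exchanging two neighbouring generators. -/
lemma exists_swap (T : SLTM F n) {k k' : Fin n} (hk : (k' : ℕ) = k + 1) (h0 : T.1 k' k = 0) :
    ∃ S : SLTM F n, T.Equivalent S ∧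
      ∀ i j, S.1 i j = T.1 (Equiv.swap k k' i) (Equiv.swap k k' j) := by
  let S : SLTM F n := ⟨fun i j => T.1 (Equiv.swap k k' i) (Equiv.swap k k' j), by
    intro i j hij
    change T.1 (Equiv.swap k k' i) (Equiv.swap k k' j) = 0
    -- Exchanging neighbours reverses the order of this pair only, and its entry vanishes by `h0`.
    by_cases h : Equiv.swap k k' i = k' ∧ Equiv.swap k k' j = k
    · rw [h.1, h.2, h0]
    · refine T.2 _ _ ?_
      rw [Equiv.swap_apply_def, Equiv.swap_apply_def] at *
      simp only [Fin.le_def, Fin.ext_iff] at *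
      split_ifs at * <;> omega⟩
  refine ⟨S, ?_, fun _ _ => rfl⟩
  let P : (Fin n → F) →ₗ[F] (Fin n → F) := LinearMap.funLeft F F (Equiv.swap k k')
  have hPP : ∀ v, P (P v) = v := fun v => funext fun i => by
    simp [P, LinearMap.funLeft_apply]
  have hsingle : ∀ i, P (Pi.single i 1) = Pi.single (Equiv.swap k k' i) 1 := fun i => by
    funext j
    rw [LinearMap.funLeft_apply, Pi.single_apply, Pi.single_apply]
    congr 1
    rw [eq_iff_iff, Equiv.swap_apply_eq_iff]
  have hrow : ∀ i, P (T.1 i) = S.1 (Equiv.swap k k' i) := fun i => funext fun j => by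
    simp [P, S, LinearMap.funLeft_apply]
  refine equivalent_of_linear P P hPP hPP (fun i => ?_) fun i => ?_
  · rw [hsingle, hrow]
    exact S.gen_rel _
  · have : P (S.1 i) = T.1 (Equiv.swap k k' i) := by
      rw [← hPP (T.1 (Equiv.swap k k' i)), hrow, Equiv.swap_apply_self]
    rw [hsingle, this]
    exact T.gen_rel _

/-! ### Existence of reduced echelon forms -/

/-- Thanks to lexicographic order, a move that lowers the `k`-th component may change the later ones
arbitrarily. -/
lemma exists_lex_min {α : Type*} (Q : α → Prop) (c : α → Fin n → ℕ) (hQ : ∃ x, Q x) :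
    ∃ x, Q x ∧ ∀ y, Q y → ∀ k, (∀ i < k, c y i = c x i) → c x k ≤ c y k := by
  have wf : WellFounded fun x y : α => toLex (c x) < toLex (c y) :=
    InvImage.wf (fun x => toLex (c x)) wellFounded_lt
  obtain ⟨x, hx, hmin⟩ := wf.has_min {x | Q x} hQ
  refine ⟨x, hx, fun y hy k hk => ?_⟩
  by_contra hlt
  exact hmin y hy ⟨k, hk, not_le.1 hlt⟩

/-- Minimize the sequence of leaders over the equivalence class. A descent between neighbouring rows
could be removed by an exchange, and a row with all `Δ` zero at its leader could be shortened by a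
shear. Zero rows have leader `0`, so monotonicity puts them on top. -/
lemma exists_isFirstREF (hF : (2 : F) ≠ 0) (T : SLTM F n) :
    ∃ R : SLTM F n, R.IsFirstREF ∧ T.Equivalent R := by
  obtain ⟨R, hTR, hmin⟩ := exists_lex_min (fun S : SLTM F n => T.Equivalent S)
    (fun S k => S.lead (k + 1)) ⟨T, Equivalent.refl T⟩
  refine ⟨R, Or.inr ?_, hTR⟩
  have hlead : ∀ (S : SLTM F n) (k : Fin n), S.1 k = R.1 k → S.lead (k + 1) = R.lead (k + 1) := by
    intro S k h
    refine eq_of_forall_gt_iff fun b => ?_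
    rcases Nat.eq_zero_or_pos b with rfl | hb
    · simp
    · rw [lead_succ_lt _ _ hb, lead_succ_lt _ _ hb, h]
  have hmono : ∀ r : ℕ, 1 ≤ r → r + 1 ≤ n → R.lead r ≤ R.lead (r + 1) := by
    intro r h1 h2
    by_contra hlt
    obtain ⟨k, rfl⟩ := exists_fin_of_pos (n := n) h1 (by omega)
    obtain ⟨k', hk'⟩ := exists_fin_of_pos (n := n) (r := k + 1 + 1) (by omega) h2
    rw [hk'] at hlt
    have hkk : (k' : ℕ) = k + 1 := by omega
    have hzero : ∀ i, k ≤ i → R.1 k' i = 0 := by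
      have := R.lead_succ_le k
      intro i hi
      rw [Fin.le_def] at hi
      exact (R.lead_succ_lt k' (b := k + 1) (by omega)).1 (by omega) i (by omega)
    obtain ⟨S, hRS, hS⟩ := R.exists_swap hkk (hzero k le_rfl)
    have hSk : S.1 k = R.1 k' := by
      funext j
      rw [hS, Equiv.swap_apply_left]
      rcases lt_or_ge j k with hj | hj
      · rw [Equiv.swap_apply_of_ne_of_ne hj.ne (by rintro rfl; rw [Fin.lt_def] at hj; omega)]
      · rw [hzero j hj, hzero]
        rw [Equiv.swap_apply_def]
        split_ifs
        · rw [Fin.le_def]; omega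
        · exact le_rfl
        · exact hj
    have hSi : ∀ i < k, S.1 i = R.1 i := by
      intro i hi
      rw [Fin.lt_def] at hi
      funext j
      rw [hS, Equiv.swap_apply_of_ne_of_ne (by rintro rfl; omega) (by rintro rfl; omega)]
      by_cases hj : j = k ∨ j = k'
      · rw [R.2 i j, R.2]
        · rcases hj with rfl | rfl
          · rw [Equiv.swap_apply_left, Fin.le_def]; omega
          · rw [Equiv.swap_apply_right, Fin.le_def]; omega
        · rw [Fin.le_def]
          rcases hj with rfl | rfl <;> omega
      · rw [not_or] at hj
        rw [Equiv.swap_apply_of_ne_of_ne hj.1 hj.2]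
    have h3 := hmin S (hTR.trans hRS) k fun i hi => hlead S i (hSi i hi)
    have h4 : S.lead (k + 1) = R.lead (k' + 1) := by
      refine eq_of_forall_gt_iff fun b => ?_
      rcases Nat.eq_zero_or_pos b with rfl | hb
      · simp
      · rw [lead_succ_lt _ _ hb, lead_succ_lt _ _ hb, hSk]
    omega
  refine ⟨?_, ?_, fun r h1 h2 _ _ => hmono r h1 h2⟩
  · intro r s hr1 hr2 hs1 hs2 hr hs
    by_contra hle
    have hle' : R.lead s ≤ R.lead r := by
      have : ∀ t, s ≤ t → t ≤ n → R.lead s ≤ R.lead t := by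
        intro t hst
        induction t, hst using Nat.le_induction with
        | base => exact fun _ => le_rfl
        | succ t hst ih => exact fun ht => (ih (by omega)).trans (hmono t (by omega) ht)
      exact this r (not_lt.1 hle) hr2
    obtain ⟨k, rfl⟩ := exists_fin_of_pos hr1 hr2
    obtain ⟨l, rfl⟩ := exists_fin_of_pos hs1 hs2
    rw [(R.lead_succ_eq_zero k).2 ((R.rowZero_succ k).1 hr), Nat.le_zero, lead_succ_eq_zero,
      ← rowZero_succ] at hle'
    exact hs hle'
  · intro r h1 h2 hr
    obtain ⟨k, rfl⟩ := exists_fin_of_pos h1 h2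
    rw [rowZero_succ] at hr
    rw [← strongRow_iff _ _ hr]
    by_contra hweak
    obtain ⟨c, hc1, hc2, hc3⟩ := R.exists_lead hr
    obtain ⟨S, hRS, hSi, hSk⟩ := R.exists_lead_lt hF hc1 hc2 fun i hi => by
      by_contra hne
      exact hweak ⟨c, hc1, hc2, i, hi, hne⟩
    have h3 := hmin S (hTR.trans hRS) k fun i hi => hlead S i (hSi i hi)
    have h4 : S.lead (k + 1) < c + 1 :=
      (S.lead_succ_lt k (by omega)).2 fun i hi => hSk i (Fin.le_def.2 (by omega))
    omega

/-- The leader usually moves along with its column. The exception is a leader in column `k'` with a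
nonzero entry in column `k`: after the exchange, column `k'` still holds the leader, with a
different value. -/
lemma StrongRow.swap (hF : (2 : F) ≠ 0) {T S : SLTM F n} {k k' : Fin n} (hk : (k' : ℕ) = k + 1) (h0 : T.1 k' k = 0)
    (hS : ∀ i j, S.1 i j = T.1 (Equiv.swap k k' i) (Equiv.swap k k' j)) {i : Fin n}
    (h : T.StrongRow (Equiv.swap k k' i)) : S.StrongRow i := by
  obtain ⟨c, hc1, hc2, m, hm, hd⟩ := h
  have h0' : T.1 k k' = 0 := T.2 k k' (Fin.le_def.2 (by omega))
  have hfix : ∀ x, x ≠ k → x ≠ k' → Equiv.swap k k' x = x :=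
    fun x => Equiv.swap_apply_of_ne_of_ne
  have hlt : ∀ x y : Fin n, x < y ↔ (x : ℕ) < y := fun x y => Fin.lt_def
  by_cases hck' : c = k'
  · subst hck'
    by_cases hz : T.1 (Equiv.swap k c i) k = 0
    · have hmk : m ≠ k := by
        rintro rfl
        rw [hz, h0] at hd
        simp at hd
      rw [hlt] at hm
      have hmk' : (m : ℕ) < k := by
        have : (m : ℕ) ≠ k := fun h => hmk (Fin.ext h)
        omega
      have hm' := hfix m hmk (by rintro rfl; omega)
      refine ⟨k, ?_, ?_, m, hmk', ?_⟩
      · rwa [hS, Equiv.swap_apply_left]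
      · intro x hx
        rw [hS]
        by_cases hxc : x = c
        · rw [hxc, Equiv.swap_apply_right, hz]
        · rw [hfix x (ne_of_gt hx) hxc]
          refine hc2 x ?_
          have : (x : ℕ) ≠ c := fun h => hxc (Fin.ext h)
          rw [gt_iff_lt, hlt] at hx ⊢
          omega
      · rwa [hS, hS, hS, Equiv.swap_apply_left, hm']
    -- The old leader now stands in column `k`, and the entry of row `k'` there is zero, so this `Δ`
    -- is twice the old leader.
    · refine ⟨c, ?_, ?_, k, (hlt _ _).2 (by omega), ?_⟩
      · rwa [hS, Equiv.swap_apply_right]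
      · intro x hx
        rw [gt_iff_lt, hlt] at hx
        rw [hS, hfix x (by rintro rfl; omega) (by rintro rfl; omega)]
        exact hc2 x ((hlt _ _).2 hx)
      · rw [hS, hS, hS, Equiv.swap_apply_left, Equiv.swap_apply_right, h0', mul_zero, add_zero]
        exact mul_ne_zero hF hc1
  · by_cases hck : c = k
    · subst hck
      rw [hlt] at hm
      have hm' := hfix m (by rintro rfl; omega) (by rintro rfl; omega)
      refine ⟨k', ?_, ?_, m, (hlt _ _).2 (by omega), ?_⟩
      · rwa [hS, Equiv.swap_apply_right]
      · intro x hx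
        rw [gt_iff_lt, hlt] at hx
        rw [hS, hfix x (by rintro rfl; omega) (by rintro rfl; omega)]
        exact hc2 x ((hlt _ _).2 (by omega))
      · rwa [hS, hS, hS, Equiv.swap_apply_right, hm']
    · have hc' := hfix c hck hck'
      have hside : ∀ x, c < Equiv.swap k k' x ↔ c < x := by
        intro x
        rw [Equiv.swap_apply_def]
        have h1 : (c : ℕ) ≠ k := fun h => hck (Fin.ext h)
        have h2 : (c : ℕ) ≠ k' := fun h => hck' (Fin.ext h)
        split_ifs with h3 h4
        · rw [h3, hlt, hlt]; omega
        · rw [h4, hlt, hlt]; omega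
        · rfl
      refine ⟨c, ?_, ?_, Equiv.swap k k' m, ?_, ?_⟩
      · rwa [hS, hc']
      · intro x hx
        rw [hS]
        exact hc2 _ ((hside x).2 hx)
      · refine lt_of_le_of_ne (not_lt.1 fun h => ?_) fun h => ?_
        · exact absurd ((hside m).1 h) (not_lt.2 hm.le)
        · rw [Equiv.swap_apply_eq_iff, hc'] at h
          exact hm.ne h
      · rwa [hS, hS, hS, hc', Equiv.swap_apply_self]

/-! ### Sorting the rows inside the blocks -/

lemma supportCard_of_perm {T S : SLTM F n} {π : Equiv.Perm (Fin n)}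
    (hS : ∀ i j, S.1 i j = T.1 (π i) (π j)) {b c : ℕ}
    (hb : ∀ x, b ≤ (π x : ℕ) + 1 ↔ b ≤ (x : ℕ) + 1)
    (hc : ∀ x, c ≤ (π x : ℕ) + 1 ↔ c ≤ (x : ℕ) + 1) (i : Fin n) :
    S.supportCard b c i = T.supportCard b c (π i) := by
  classical
  rw [supportCard, supportCard, ← Finset.card_image_of_injective _ π.injective]
  congr 1
  ext x
  simp only [Finset.mem_filter, Finset.mem_univ, true_and, Finset.mem_image, hS, ← not_le]
  constructor
  · rintro ⟨y, ⟨h1, h2, h3⟩, rfl⟩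
    exact ⟨(hb y).2 h1, (hc y).not.2 h2, h3⟩
  · rintro ⟨h1, h2, h3⟩
    refine ⟨π.symm x, ⟨?_, ?_, ?_⟩, π.apply_symm_apply x⟩
    · rwa [← hb, π.apply_symm_apply]
    · rwa [← hc, π.apply_symm_apply]
    · rwa [π.apply_symm_apply]

/-- The leader of a row may change under the permutation, so its nonzero `Δ` comes from `hstrong`;
its position at or beyond the previous cut comes from the image of an old entry. -/
lemma Layered.swap {T S : SLTM F n} {b : ℕ → ℕ} {h : ℕ} (hT : T.Layered b h)
    (hstrong : ∀ k, S.1 k ≠ 0 → S.StrongRow k) {π : Equiv.Perm (Fin n)}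
    (hS : ∀ i j, S.1 i j = T.1 (π i) (π j))
    (hπ : ∀ m ≤ h + 1, ∀ x, b m ≤ (π x : ℕ) + 1 ↔ b m ≤ (x : ℕ) + 1) : S.Layered b h where
  zero := hT.zero
  top := hT.top
  mono := hT.mono
  lt := hT.lt
  row := by
    intro j hj k h1 h2 i hi
    rw [← not_le] at h2
    rw [hS]
    exact hT.row j hj (π k) ((hπ j (by omega) k).2 h1)
      (not_le.1 ((hπ (j + 1) (by omega) k).not.2 h2)) _ ((hπ j (by omega) i).2 hi)
  delta := by
    intro j hj k h1 h2
    rw [← not_le] at h2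
    obtain ⟨c, hc1, hc2, -⟩ := hT.delta j hj (π k) ((hπ (j + 1) (by omega) k).2 h1)
      (not_le.1 ((hπ (j + 2) (by omega) k).not.2 h2))
    have hne : S.1 k (π.symm c) ≠ 0 := by rwa [hS, π.apply_symm_apply]
    obtain ⟨d, hd1, hd2, hd3⟩ := hstrong k fun h => hne (congrFun h _)
    refine ⟨d, ?_, hd1, hd3⟩
    have h3 : π.symm c ≤ d := by
      by_contra hlt
      exact hne (hd2 _ (not_le.1 hlt))
    have h4 : b j ≤ (π.symm c : ℕ) + 1 := by
      rwa [← hπ j (by omega), π.apply_symm_apply]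
    rw [Fin.le_def] at h3
    omega

lemma Layered.exists_sorted (hF : (2 : F) ≠ 0) {T : SLTM F n} {b : ℕ → ℕ} {h : ℕ}
    (hT : T.Layered b h) (hstrong : ∀ k, T.1 k ≠ 0 → T.StrongRow k) :
    ∃ V : SLTM F n, T.Equivalent V ∧ V.Layered b h ∧ (∀ k, V.1 k ≠ 0 → V.StrongRow k) ∧
      ∀ j < h, ∀ k k' : Fin n, (k' : ℕ) = k + 1 → b (j + 1) ≤ k + 1 → k' + 1 < b (j + 2) →
        V.supportCard (b j) (b (j + 1)) k ≤ V.supportCard (b j) (b (j + 1)) k' := by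
  have hblock : ∀ k : Fin n, ∃ j, j ≤ h ∧ b j ≤ k + 1 ∧ k + 1 < b (j + 1) := fun k => by
    obtain ⟨j, -, hj⟩ := hT.exists_block (m := 0) (k := k) (by omega) (by rw [hT.zero]; omega)
    exact ⟨j, hj⟩
  choose J hJ1 hJ2 hJ3 using hblock
  obtain ⟨V, ⟨hTV, hV, hVs⟩, hmin⟩ := exists_lex_min
    (fun S : SLTM F n => T.Equivalent S ∧ S.Layered b h ∧ ∀ k, S.1 k ≠ 0 → S.StrongRow k)
    -- For `J k = 0` truncated subtraction makes the range of columns empty, so zero rows have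
    -- measure `0`.
    (fun S k => S.supportCard (b (J k - 1)) (b (J k)) k) ⟨T, Equivalent.refl T, hT, hstrong⟩
  refine ⟨V, hTV, hV, hVs, fun j hj k k' hk h1 h2 => ?_⟩
  have h0 : V.1 k' k = 0 := hV.row (j + 1) hj k' (by omega) h2 k h1
  obtain ⟨S, hVS, hS⟩ := V.exists_swap hk h0
  have hSs : ∀ i, S.1 i ≠ 0 → S.StrongRow i := by
    intro i hi
    refine StrongRow.swap hF hk h0 hS (hVs _ fun h => hi ?_)
    funext x
    rw [hS, h]
    rfl
  have hπ : ∀ m ≤ h + 1, ∀ x, b m ≤ (Equiv.swap k k' x : ℕ) + 1 ↔ b m ≤ (x : ℕ) + 1 := by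
    intro m hm x
    have hkk : b m ≤ k + 1 ↔ b m ≤ (k' : ℕ) + 1 := by
      refine ⟨fun h => by omega, fun h3 => ?_⟩
      rcases le_or_gt m (j + 1) with hmj | hmj
      · exact (hT.mono' hmj (by omega)).trans h1
      · have := hT.mono' (i := j + 2) (j := m) hmj hm
        omega
    rw [Equiv.swap_apply_def]
    split_ifs with h3 h4
    · rw [h3, hkk]
    · rw [h4, hkk]
    · rfl
  have hcard := fun m (hm : m ≤ h + 1) m' (hm' : m' ≤ h + 1) =>
    supportCard_of_perm hS (hπ m hm) (hπ m' hm')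
  have hJk : J k = j + 1 := hT.block_unique (hJ1 k) hj (hJ2 k) (hJ3 k) h1
    (show (k : ℕ) + 1 < b (j + 2) by omega)
  have := hmin S ⟨hTV.trans hVS, hV.swap hSs hS hπ, hSs⟩ k fun i hi => by
    rw [Fin.lt_def] at hi
    have := hJ1 i
    rw [hcard _ (by omega) _ (by omega),
      Equiv.swap_apply_of_ne_of_ne (by rintro rfl; omega) (by rintro rfl; omega)]
  rwa [hJk, hcard _ (by omega) _ (by omega), Equiv.swap_apply_left, Nat.add_sub_cancel] at this

/-! ### Second reduced echelon form -/

lemma exists_isSecondREF (hF : (2 : F) ≠ 0) (T : SLTM F n) :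
    ∃ V : SLTM F n, V.IsSecondREF ∧ T.Equivalent V := by
  classical
  obtain ⟨R, hR, hTR⟩ := exists_isFirstREF hF T
  by_cases hR0 : R = 0
  · exact ⟨R, Or.inl hR0, hTR⟩
  obtain ⟨hlay, hnil, hstrong⟩ := hR.layered hR0
  obtain ⟨V, hRV, hV, hVs, hsort⟩ := hlay.exists_sorted hF hstrong
  have hwall : V.wall = R.firstWall := wall_eq hF hR hRV.symm
  have hbound : ∀ j, V.bound j = cut n R.firstWall j := fun j => by rw [bound, hwall]; rfl
  have hlen : 1 ≤ R.firstWall.length := List.length_pos_iff.2 hnil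
  have hpos : ∀ j ≤ R.firstWall.length + 1, 1 ≤ cut n R.firstWall j := fun j hj => by
    rw [← cut_zero (n := n) R.firstWall]
    exact hV.mono' (Nat.zero_le _) hj
  have hzero : ∀ k : Fin n, V.1 k = 0 ↔ (k : ℕ) + 1 < cut n R.firstWall 1 := by
    intro k
    constructor
    · intro hk
      by_contra hlt
      obtain ⟨j, hj0, hj1, hj2, hj3⟩ := hV.exists_block (m := 1) (by omega) (not_lt.1 hlt)
      obtain ⟨j, rfl⟩ : ∃ i, j = i + 1 := ⟨j - 1, by omega⟩
      obtain ⟨c, -, hc, -⟩ := hV.delta j hj1 k hj2 hj3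
      exact hc (congrFun hk c)
    · intro hk
      have := hV.row 0 (by omega) k (by rw [cut_zero]; omega) hk
      exact funext fun i => this i (by rw [cut_zero]; omega)
  refine ⟨V, Or.inr ⟨fun h => hR.not_equivalent_zero hR0 hF (hRV.trans h), ⟨?_, ?_⟩, ⟨?_, ?_⟩, ?_⟩,
    hTR.trans hRV⟩
  · have : (Finset.Icc 1 n).filter (fun r => V.RowZero r) =
        Finset.Ico 1 (cut n R.firstWall 1) := by
      ext r
      rw [Finset.mem_filter, Finset.mem_Icc, Finset.mem_Ico]
      constructor
      · rintro ⟨⟨h1, h2⟩, h3⟩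
        obtain ⟨k, rfl⟩ := exists_fin_of_pos h1 h2
        exact ⟨h1, (hzero k).1 ((V.rowZero_succ k).1 h3)⟩
      · rintro ⟨h1, h2⟩
        have h3 := hV.le le_rfl hlen
        obtain ⟨k, rfl⟩ := exists_fin_of_pos (n := n) h1 (by omega)
        exact ⟨⟨h1, by omega⟩, (V.rowZero_succ k).2 ((hzero k).2 h2)⟩
    rw [this, Nat.card_Ico, hbound]
    have := hpos 1 (by omega)
    omega
  · intro r s hr1 hr2 hs1 hs2 hr hs
    obtain ⟨k, rfl⟩ := exists_fin_of_pos hr1 hr2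
    obtain ⟨l, rfl⟩ := exists_fin_of_pos hs1 hs2
    rw [rowZero_succ, hzero] at hr hs
    omega
  · intro r h1 h2 h3
    obtain ⟨k, rfl⟩ := exists_fin_of_pos h1 h2
    rw [rowZero_succ] at h3
    exact (V.strongRow_iff k h3).1 (hVs k h3)
  · intro j hj1 hj2 r hr1 hr2
    obtain ⟨j, rfl⟩ : ∃ i, j = i + 1 := ⟨j - 1, by omega⟩
    rw [hwall] at hj2
    rw [hbound] at hr1 hr2
    rw [hbound, hbound, Nat.add_sub_cancel]
    have h1 := hpos (j + 1) (by omega)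
    have h2 := hV.mono' (i := j + 1 + 1) (j := R.firstWall.length + 1) (by omega) le_rfl
    rw [cut_top] at h2
    obtain ⟨k, rfl⟩ := exists_fin_of_pos (n := n) (r := r) (by omega) (by omega)
    refine ⟨?_, (V.lead_succ_lt k h1).2 (hV.row (j + 1) hj2 k hr1 hr2)⟩
    obtain ⟨c, hc1, hc2, -⟩ := hV.delta j hj2 k hr1 hr2
    by_contra hlt
    exact hc2 ((V.lead_succ_lt k (hpos j (by omega))).1 (not_le.1 hlt) c hc1)
  · intro j hj1 hj2 r hr1 hr2
    obtain ⟨j, rfl⟩ : ∃ i, j = i + 1 := ⟨j - 1, by omega⟩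
    rw [hwall] at hj2
    rw [hbound] at hr1 hr2
    have h1 := hpos (j + 1) (by omega)
    have h2 := hV.mono' (i := j + 1 + 1) (j := R.firstWall.length + 1) (by omega) le_rfl
    rw [cut_top] at h2
    obtain ⟨k, rfl⟩ := exists_fin_of_pos (n := n) (r := r) (by omega) (by omega)
    obtain ⟨k', hk'⟩ := exists_fin_of_pos (n := n) (r := k + 1 + 1) (by omega) (by omega)
    rw [brickMeasure, brickMeasure, hbound, hbound, Nat.add_sub_cancel, hk',
      rowMeasure_succ _ _ (hpos j (by omega)), rowMeasure_succ _ _ (hpos j (by omega))]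
    exact hsort j hj2 k k' (by omega) hr1
      (show (k' : ℕ) + 1 < cut n R.firstWall (j + 1 + 1) by omega)

/-- The inequalities between the cuts come from an equivalent 1-REF, which defines the wall; the
conditions on the rows come from the 2-REF itself. The prescribed number of zero rows, all on top,
makes block `0` exactly the set of zero rows. -/
lemma IsSecondREF.layered {V : SLTM F n} (hV : V.IsSecondREF) (h0 : V ≠ 0) (hF : (2 : F) ≠ 0) :
    V.Layered V.bound V.wall.length := by
  classical
  obtain ⟨hne, ⟨hcard, hz⟩, ⟨hstrong, hlead⟩, -⟩ := hV.resolve_left h0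
  obtain ⟨R, hR, hVR⟩ := exists_isFirstREF hF V
  have hR0 : R ≠ 0 := by
    rintro rfl
    exact hne hVR
  have hlay := (hR.layered hR0).1
  have hwall : V.wall = R.firstWall := wall_eq hF hR hVR
  rw [← hwall] at hlay
  have hpos : ∀ j ≤ V.wall.length + 1, 1 ≤ V.bound j := fun j hj => by
    change 1 ≤ cut n V.wall j
    rw [← cut_zero (n := n) V.wall]
    exact hlay.mono' (Nat.zero_le _) hj
  have hzero : ∀ k : Fin n, V.1 k = 0 ↔ (k : ℕ) + 1 < V.bound 1 := by
    intro k
    constructor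
    · intro hk
      have hsub : Finset.Icc 1 ((k : ℕ) + 1) ⊆
          (Finset.Icc 1 n).filter (fun r => V.RowZero r) := by
        intro s hs
        rw [Finset.mem_Icc] at hs
        rw [Finset.mem_filter, Finset.mem_Icc]
        refine ⟨by omega, ?_⟩
        by_contra hs'
        have := hz (k + 1) s (by omega) (by omega) (by omega) (by omega)
          ((V.rowZero_succ k).2 hk) hs'
        omega
      have := Finset.card_le_card hsub
      rw [Nat.card_Icc] at this
      omega
    · intro hk
      by_contra h
      have hsub : (Finset.Icc 1 n).filter (fun r => V.RowZero r) ⊆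
          Finset.Ico 1 ((k : ℕ) + 1) := by
        intro s hs
        rw [Finset.mem_filter, Finset.mem_Icc] at hs
        rw [Finset.mem_Ico]
        exact ⟨hs.1.1, hz s (k + 1) (by omega) (by omega) (by omega) (by omega) hs.2
          ((V.rowZero_succ k).not.2 h)⟩
      have := Finset.card_le_card hsub
      rw [Nat.card_Ico] at this
      omega
  refine ⟨hlay.zero, hlay.top, hlay.mono, hlay.lt, ?_, ?_⟩
  · intro j hj k h1 h2
    cases j with
    | zero => exact fun i _ => congrFun ((hzero k).2 h2) i
    | succ j =>
      exact (V.lead_succ_lt k (hpos _ (by omega))).1 (hlead (j + 1) (by omega) hj _ h1 h2).2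
  · intro j hj k h1 h2
    have hk : V.1 k ≠ 0 := by
      rw [Ne, hzero]
      have : V.bound 1 ≤ V.bound (j + 1) := hlay.mono' (by omega) (by omega)
      omega
    obtain ⟨c, hc1, hc2, hc3⟩ := (V.strongRow_iff k hk).2
      (hstrong _ (by omega) (by omega) ((V.rowZero_succ k).not.2 hk))
    refine ⟨c, ?_, hc1, hc3⟩
    have := (hlead (j + 1) (by omega) hj _ h1 h2).1
    rwa [V.lead_succ_eq hc1 hc2] at this

/-! ### Comparison of two matrices in second reduced echelon form -/

lemma le_of_perm_of_monotone {f g : Fin n → ℕ} {σ : Equiv.Perm (Fin n)} {a b : ℕ}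
    (hσ : ∀ k : Fin n, a ≤ k + 1 → k + 1 < b → a ≤ σ k + 1 ∧ σ k + 1 < b)
    (hfg : ∀ k : Fin n, a ≤ k + 1 → k + 1 < b → g (σ k) = f k)
    (hf : ∀ k l : Fin n, a ≤ k + 1 → k ≤ l → l + 1 < b → f k ≤ f l)
    (hg : ∀ k l : Fin n, a ≤ k + 1 → k ≤ l → l + 1 < b → g k ≤ g l)
    (k : Fin n) (h1 : a ≤ k + 1) (h2 : k + 1 < b) : f k ≤ g k := by
  classical
  by_contra hlt
  -- Pigeonhole: if `g k < f k`, all indices of the block from `k` on are sent by `σ` to indices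
  -- where `g` exceeds `g k`, that is, strictly beyond `k`.
  have hsub : (Finset.univ.filter fun l : Fin n => k ≤ l ∧ (l : ℕ) + 1 < b).image σ ⊆
      (Finset.univ.filter fun l : Fin n => k ≤ l ∧ (l : ℕ) + 1 < b).erase k := by
    intro x hx
    obtain ⟨l, hl, rfl⟩ := Finset.mem_image.1 hx
    simp only [Finset.mem_filter, Finset.mem_univ, true_and] at hl
    have hl1 : a ≤ l + 1 := h1.trans (Nat.succ_le_succ hl.1)
    obtain ⟨h3, h4⟩ := hσ l hl1 hl.2
    have h5 : g k < g (σ l) := by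
      rw [hfg l hl1 hl.2]
      exact (not_le.1 hlt).trans_le (hf k l h1 hl.1 hl.2)
    rw [Finset.mem_erase, Finset.mem_filter]
    refine ⟨fun h => by rw [h] at h5; omega, Finset.mem_univ _, ?_, h4⟩
    by_contra h6
    exact absurd (hg _ _ h3 (not_le.1 h6).le h2) (not_le.2 h5)
  have := Finset.card_le_card hsub
  rw [Finset.card_image_of_injective _ σ.injective] at this
  exact absurd this (not_le.2 (Finset.card_erase_lt_of_mem
    (Finset.mem_filter.2 ⟨Finset.mem_univ k, le_rfl, h2⟩)))

lemma IsSecondREF.eq_zero_of_equivalent {S T : SLTM F n} (hT : T.IsSecondREF) (hS : S = 0)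
    (h : S.Equivalent T) : T = 0 := by
  by_contra hT0
  exact (hT.resolve_left hT0).1 (hS ▸ h.symm)

lemma IsSecondREF.supportCard_mono {V : SLTM F n} (hV : V.IsSecondREF) (h0 : V ≠ 0)
    (hF : (2 : F) ≠ 0) {j : ℕ} (hj : j < V.wall.length) {k l : Fin n}
    (hk : V.bound (j + 1) ≤ k + 1) (hkl : k ≤ l) (hl : l + 1 < V.bound (j + 2)) :
    V.supportCard (V.bound j) (V.bound (j + 1)) k ≤
      V.supportCard (V.bound j) (V.bound (j + 1)) l := by
  have hlay := hV.layered h0 hF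
  have hpos : 1 ≤ V.bound j := by
    rw [← hlay.zero]
    exact hlay.mono' (Nat.zero_le _) (by omega)
  rw [← rowMeasure_succ _ _ hpos, ← rowMeasure_succ _ _ hpos]
  have key : ∀ s, (k : ℕ) + 1 ≤ s → s < V.bound (j + 2) →
      V.rowMeasure (V.bound j) (V.bound (j + 1)) (k + 1) ≤
        V.rowMeasure (V.bound j) (V.bound (j + 1)) s := by
    intro s hs
    induction s, hs using Nat.le_induction with
    | base => exact fun _ => le_rfl
    | succ s hs ih =>
      intro hlt
      exact (ih (by omega)).trans
        ((hV.resolve_left h0).2.2.2 (j + 1) (by omega) hj s (by omega) hlt)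
  exact key _ (Nat.succ_le_succ hkl) hl

lemma wall_eq_of_equivalent {S T : SLTM F n} (hF : (2 : F) ≠ 0) (h : S.Equivalent T) :
    S.wall = T.wall := by
  obtain ⟨R, hR, hTR⟩ := exists_isFirstREF hF T
  rw [wall_eq hF hR hTR, wall_eq hF hR (h.trans hTR)]

lemma bound_eq_of_equivalent {S T : SLTM F n} (hF : (2 : F) ≠ 0) (h : S.Equivalent T) (j : ℕ) :
    S.bound j = T.bound j := by
  rw [bound, bound, wall_eq_of_equivalent hF h]

lemma IsSecondREF.supportCard_le {S T : SLTM F n} (hS : S.IsSecondREF) (hT : T.IsSecondREF)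
    (hS0 : S ≠ 0) (hT0 : T ≠ 0) (hF : (2 : F) ≠ 0) (h : S.Equivalent T) {j : ℕ}
    (hj : j < S.wall.length) {k : Fin n} (h1 : S.bound (j + 1) ≤ k + 1)
    (h2 : k + 1 < S.bound (j + 2)) :
    S.supportCard (S.bound j) (S.bound (j + 1)) k ≤
      T.supportCard (S.bound j) (S.bound (j + 1)) k := by
  have hb : T.bound = S.bound := funext fun j => (bound_eq_of_equivalent hF h j).symm
  have hw : T.wall = S.wall := (wall_eq_of_equivalent hF h).symm
  have hSl := hS.layered hS0 hF
  have hTl := hT.layered hT0 hF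
  rw [hb, hw] at hTl
  obtain ⟨σ, hσ1, hσ2⟩ := hSl.exists_perm hTl hF h
  refine le_of_perm_of_monotone (σ := σ) (a := S.bound (j + 1)) (b := S.bound (j + 2))
    (f := S.supportCard (S.bound j) (S.bound (j + 1)))
    (g := T.supportCard (S.bound j) (S.bound (j + 1)))
    (hσ1 (j + 1) hj) (hσ2 j hj) ?_ ?_ k h1 h2
  · exact fun k l hk hkl hl => hS.supportCard_mono hS0 hF hj hk hkl hl
  · intro k l hk hkl hl
    have := hT.supportCard_mono hT0 hF (j := j) (k := k) (l := l) (by rwa [hw]) (by rwa [hb]) hkl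
      (by rwa [hb])
    rwa [hb] at this

/-- Row by row the brick measures agree, by `IsSecondREF.supportCard_le` in both directions, so the
greedy selections of rows agree as well. -/
lemma IsSecondREF.secondMeasureSeq_eq {S T : SLTM F n} (hS : S.IsSecondREF) (hT : T.IsSecondREF)
    (hF : (2 : F) ≠ 0) (h : S.Equivalent T) : S.secondMeasureSeq = T.secondMeasureSeq := by
  by_cases hS0 : S = 0
  · rw [hS0, hT.eq_zero_of_equivalent hS0 h]
  have hT0 : T ≠ 0 := fun hT0 => hS0 (hS.eq_zero_of_equivalent hT0 h.symm)
  have hb : T.bound = S.bound := funext fun j => (bound_eq_of_equivalent hF h j).symm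
  have hw : T.wall = S.wall := (wall_eq_of_equivalent hF h).symm
  have hlay := hS.layered hS0 hF
  rw [secondMeasureSeq, secondMeasureSeq, hw]
  refine List.map_congr_left fun j hj => ?_
  rw [List.mem_range] at hj
  have hlt := hlay.lt (j + 1) (by omega) hj
  have htop := hlay.mono' (i := j + 2) (by omega) le_rfl
  have hpos : ∀ m ≤ S.wall.length + 1, 1 ≤ S.bound m := fun m hm => by
    rw [← hlay.zero]
    exact hlay.mono' (Nat.zero_le _) hm
  rw [hlay.top] at htop
  have key : ∀ s, S.bound (j + 1) ≤ s → s ≤ S.bound (j + 2) - 1 →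
      S.brickMeasure (j + 1) s = T.brickMeasure (j + 1) s := by
    intro s hs1 hs2
    have := hpos (j + 1) (by omega)
    obtain ⟨k, rfl⟩ := exists_fin_of_pos (n := n) (r := s) (by omega) (by omega)
    rw [brickMeasure, brickMeasure, hb, Nat.add_sub_cancel,
      rowMeasure_succ _ _ (hpos j (by omega)), rowMeasure_succ _ _ (hpos j (by omega))]
    refine le_antisymm (hS.supportCard_le hT hS0 hT0 hF h hj hs1 (by omega)) ?_
    have := hT.supportCard_le hS hT0 hS0 hF h.symm (j := j) (k := k) (by rwa [hw]) (by rwa [hb])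
      (by rw [hb]; omega)
    rwa [hb] at this
  rw [measureMatrix, measureMatrix, hb]
  refine greedyChain_map_congr _ _ (by omega) ?_ ?_
  · intro s t hs1 hs2 ht1 ht2
    rw [key s hs1 hs2, key t ht1 ht2]
  · intro s hs1 hs2
    rw [key s hs1 hs2]

lemma measureSeq_eq {T V : SLTM F n} (hF : (2 : F) ≠ 0) (hV : V.IsSecondREF)
    (h : T.Equivalent V) : T.measureSeq = V.secondMeasureSeq := by
  have hex : ∃ V : SLTM F n, V.IsSecondREF ∧ T.Equivalent V := ⟨V, hV, h⟩
  rw [measureSeq, dif_pos hex]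
  exact hex.choose_spec.1.secondMeasureSeq_eq hV hF (hex.choose_spec.2.symm.trans h)

end SLTM

theorem mainTheorem2 {F : Type*} [Field F] (hF : ringChar F ≠ 2) (n : ℕ) :
    -- walls are well defined
    (∀ T : SLTM F n,
      (∃ R : SLTM F n, R.IsFirstREF ∧ T.Equivalent R) ∧
        ∀ R : SLTM F n, R.IsFirstREF → T.Equivalent R → T.wall = R.firstWall) ∧
    -- the test for matrices in second reduced echelon form
    (∀ S T : SLTM F n, S.IsSecondREF → T.IsSecondREF → S.wall = T.wall →
      S.Equivalent T → S.secondMeasureSeq = T.secondMeasureSeq) ∧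
    -- the measure sequence of an arbitrary matrix is well defined
    (∀ T : SLTM F n,
      (∃ V : SLTM F n, V.IsSecondREF ∧ T.Equivalent V) ∧
        ∀ V : SLTM F n, V.IsSecondREF → T.Equivalent V →
          T.measureSeq = V.secondMeasureSeq) ∧
    -- and it is an isomorphism invariant
    (∀ S T : SLTM F n, S.Equivalent T → S.measureSeq = T.measureSeq) := by
  have h2 : (2 : F) ≠ 0 := Ring.two_ne_zero hF
  refine ⟨fun T => ⟨SLTM.exists_isFirstREF h2 T, fun R hR h => SLTM.wall_eq h2 hR h⟩,
    fun S T hS hT _ h => hS.secondMeasureSeq_eq hT h2 h,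
    fun T => ⟨SLTM.exists_isSecondREF h2 T, fun V hV h => SLTM.measureSeq_eq h2 hV h⟩,
    fun S T h => ?_⟩
  obtain ⟨V, hV, hTV⟩ := SLTM.exists_isSecondREF h2 T
  rw [SLTM.measureSeq_eq h2 hV hTV, SLTM.measureSeq_eq h2 hV (h.trans hTV)]
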